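/- For real-valued $a,b$ on $[0,1]$, consider the eigenvalue problem of the one-dimensional damped wave equation $$u''-(\lambda^2+2\lambda a-b)\,u=0 \ \text{ on } (0,1),\qquad u(0)=u(1)=0 .$$ Its spectrum is the set of all $\lambda\in\mathbb C$ for which this problem has a solution $u\in C^2([0,1];\mathbb C)$ that is not identically zero. Write $\langle f\rangle:=\int_0^1 f(x)\,dx$. Let $a_0,\tilde a_1,\tilde a_2\in C^4[0,1]$ be real-valued with $a_0(1-x)=a_0(x)$ and $\tilde a_i(1-x)=-\tilde a_i(x)$ for all $x\in[0,1]$ and $i=1,2$. Put $a_i:=a_0+\tilde a_i$ and $b\equiv 0$. If the problems with $a=a_1$ and with $a=a_2$ have the same spectrum, then $$\langle \tilde a_1^2\rangle=\langle \tilde a_2^2\rangle\qquad\text{and}\qquad \langle a_0\tilde a_1^2\rangle=\langle a_0\tilde a_2^2\rangle .$$ -/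

import Mathlib

/-- `u` is a classical solution, `C²` on `[0,1]`, of the boundary value problem
`u'' - (lam² + 2 lam a - b) u = 0` on `(0,1)`, `u(0) = u(1) = 0`.
(At a point of the open interval `deriv (deriv u)` is the genuine second derivative,
since `u` is `C²` on `[0,1]`; values of `u` outside `[0,1]` play no role.) -/
def IsDampedWaveSolution (a b : ℝ → ℝ) (lam : ℂ) (u : ℝ → ℂ) : Prop :=
  ContDiffOn ℝ 2 u (Set.Icc 0 1) ∧
  (∀ x ∈ Set.Ioo (0 : ℝ) 1,
    deriv (deriv u) x - (lam ^ 2 + 2 * lam * (a x : ℂ) - (b x : ℂ)) * u x = 0) ∧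
  u 0 = 0 ∧ u 1 = 0

/-- The spectrum of the damped wave problem with damping `a` and potential `b`: the set of
its complex eigenvalues, that is, of all `lam` for which the boundary value problem has a
solution that does not vanish identically on `[0,1]`. -/
def dampedWaveSpectrum (a b : ℝ → ℝ) : Set ℂ :=
  {lam : ℂ | ∃ u : ℝ → ℂ, IsDampedWaveSolution a b lam u ∧ ∃ x ∈ Set.Icc (0 : ℝ) 1, u x ≠ 0}

/-- The average `⟨f⟩ = ∫₀¹ f(x) dx`. -/
noncomputable def unitMean (f : ℝ → ℝ) : ℝ := ∫ x in (0 : ℝ)..1, f x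

open Set Filter Topology intervalIntegral

/-! The spectrum is probed only at eigenvalues of large imaginary part in a fixed vertical strip,
through a WKB expansion accurate enough to reveal two invariants of the damping `α` beyond its mean.

Writing a solution as `exp (∫ φ)` gives the Riccati equation `φ' + φ² = lam² + 2 lam α`. Its
expansion in powers of `1 / lam`, cut after `lam⁻²`, leaves a residual `O(lam⁻²)`. The equation is
unchanged under `(lam, α) ↦ (-lam, -α)`, which yields a second approximate solution. Their
difference vanishes at `0`, and an energy estimate (`norm_mul_abs_im_le_of_forced`) gains one more
power of `lam`, so an exact solution with the same initial data agrees with it at `1` up to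
`O(lam⁻³)`. At an eigenvalue the two exponentials therefore nearly coincide: `exp (2 (lam + ⟨α⟩) -
⟨α²⟩ / lam + c / lam²) = 1 + O(lam⁻³)` with `c = ⟨α³⟩ + (α'(1) - α'(0)) / 2`
(`exists_norm_exp_sub_one_le_of_mem_spectrum`).

Two isospectral dampings with equal means satisfy this at the same `lam`. Dividing the relations and
letting `|lam| → ∞` gives equal `⟨α²⟩` and equal `c` (`invariants_eq_of_dampedWaveSpectrum_eq`).
Arbitrarily large eigenvalues do exist in the strip, because the characteristic function is close to
`2 sinh (lam + ⟨α⟩)` (`exists_mem_dampedWaveSpectrum`).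

For `α = a₀ + t` with `a₀` even and `t` odd about `1/2`, the terms odd in `t` integrate to zero and
`t'(1) = t'(0)`. The unknown parts of the invariants are thus `⟨t²⟩` and `3 ⟨a₀ t²⟩`. -/

/-! ### Extending smooth functions from the unit interval to the line -/

theorem hasDerivAt_const_add_integral {E : Type*} [NormedAddCommGroup E] [NormedSpace ℝ E]
    [CompleteSpace E] {g : ℝ → E} (hg : Continuous g) (c : E) (x : ℝ) :
    HasDerivAt (fun x => c + ∫ t in (0 : ℝ)..x, g t) (g x) x :=
  (integral_hasDerivAt_right (hg.intervalIntegrable _ _)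
    (hg.stronglyMeasurableAtFilter _ _) hg.continuousAt).const_add _

theorem contDiff_const_add_integral {E : Type*} [NormedAddCommGroup E] [NormedSpace ℝ E]
    [CompleteSpace E] {n : ℕ} {g : ℝ → E} (hg : ContDiff ℝ n g) (c : E) :
    ContDiff ℝ (n + 1 : ℕ) (fun x => c + ∫ t in (0 : ℝ)..x, g t) := by
  have hder := hasDerivAt_const_add_integral hg.continuous c
  have : ContDiff ℝ ((n : WithTop ℕ∞) + 1) (fun x => c + ∫ t in (0 : ℝ)..x, g t) := by
    rw [contDiff_succ_iff_deriv]
    refine ⟨fun x => (hder x).differentiableAt, by simp, ?_⟩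
    rwa [show deriv (fun x => c + ∫ t in (0 : ℝ)..x, g t) = g from
      funext fun x => (hder x).deriv]
  exact_mod_cast this

theorem eqOn_const_add_integral {E : Type*} [NormedAddCommGroup E] [NormedSpace ℝ E]
    [CompleteSpace E] {f g : ℝ → E} (hf : ContinuousOn f (Icc 0 1)) (hg : Continuous g)
    (h : ∀ x ∈ Ioo (0 : ℝ) 1, HasDerivAt f (g x) x) :
    EqOn (fun x => f 0 + ∫ t in (0 : ℝ)..x, g t) f (Icc 0 1) := by
  intro x hx
  have : ∫ t in (0 : ℝ)..x, g t = f x - f 0 :=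
    integral_eq_sub_of_hasDerivAt_of_le hx.1 (hf.mono (Icc_subset_Icc_right hx.2))
      (fun t ht => h t ⟨ht.1, ht.2.trans_le hx.2⟩) (hg.intervalIntegrable _ _)
  simp [this]

/-- The top derivative is extended by constants beyond the endpoints and then integrated back up,
one order at a time. -/
theorem exists_contDiff_eqOn_Icc {E : Type*} [NormedAddCommGroup E] [NormedSpace ℝ E]
    [CompleteSpace E] (n : ℕ) (f : ℝ → E) (hf : ContDiffOn ℝ n f (Icc 0 1)) :
    ∃ g : ℝ → E, ContDiff ℝ n g ∧ EqOn g f (Icc 0 1) := by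
  induction n generalizing f with
  | zero =>
    have hc : ContinuousOn f (Icc 0 1) := by
      simpa using hf
    refine ⟨IccExtend (zero_le_one' ℝ) ((Icc (0 : ℝ) 1).domRestrict f), ?_, ?_⟩
    · have := hc.domRestrict.Icc_extend' (h := zero_le_one' ℝ)
      simpa using this
    · intro x hx
      rw [IccExtend_of_mem _ _ hx]
      rfl
  | succ n ih =>
    have h' : ContDiffOn ℝ n (derivWithin f (Icc 0 1)) (Icc 0 1) :=
      hf.derivWithin (uniqueDiffOn_Icc zero_lt_one) (by norm_cast)
    obtain ⟨g, hg, hgf⟩ := ih _ h'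
    have hd : DifferentiableOn ℝ f (Icc 0 1) := hf.differentiableOn (by simp)
    refine ⟨_, contDiff_const_add_integral hg (f 0),
      eqOn_const_add_integral hf.continuousOn hg.continuous fun t ht => ?_⟩
    rw [hgf (Ioo_subset_Icc_self ht)]
    exact (hd t (Ioo_subset_Icc_self ht)).hasDerivWithinAt.hasDerivAt (Icc_mem_nhds ht.1 ht.2)

theorem contDiffOn_succ_of_hasDerivAt_Ioo {E : Type*} [NormedAddCommGroup E] [NormedSpace ℝ E]
    [CompleteSpace E] {n : ℕ} {f f' : ℝ → E} (hf : ContinuousOn f (Icc 0 1))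
    (hf' : ContDiffOn ℝ n f' (Icc 0 1)) (h : ∀ x ∈ Ioo (0 : ℝ) 1, HasDerivAt f (f' x) x) :
    ContDiffOn ℝ (n + 1 : ℕ) f (Icc 0 1) := by
  obtain ⟨g, hg, hgf⟩ := exists_contDiff_eqOn_Icc n f' hf'
  refine (contDiff_const_add_integral hg (f 0)).contDiffOn.congr
    (eqOn_const_add_integral hf hg.continuous fun t ht => ?_).symm
  rw [hgf (Ioo_subset_Icc_self ht)]
  exact h t ht

/-! ### Energy estimate in vertical strips -/

/-- A priori bound for the forced equation `d'' = (lam² + 2 lam a) d + g` with zero initial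
data, uniformly in vertical strips. -/
theorem norm_mul_abs_im_le_of_forced {K A G : ℝ} (hK : 0 ≤ K) (hA : 0 ≤ A) {lam : ℂ}
    (hre : |lam.re| ≤ K) (him : 1 ≤ |lam.im|) {a : ℝ → ℝ} {d d₁ d₂ : ℝ → ℂ}
    (ha : ∀ x ∈ Icc (0 : ℝ) 1, |a x| ≤ A)
    (hd : ContinuousOn d (Icc 0 1)) (hd₁ : ContinuousOn d₁ (Icc 0 1))
    (hd' : ∀ x ∈ Ioo (0 : ℝ) 1, HasDerivAt d (d₁ x) x)
    (hd₁' : ∀ x ∈ Ioo (0 : ℝ) 1, HasDerivAt d₁ (d₂ x) x)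
    (hG : ∀ x ∈ Ioo (0 : ℝ) 1, ‖d₂ x - (lam ^ 2 + 2 * lam * (a x : ℂ)) * d x‖ ≤ G)
    (h0 : d 0 = 0) (h0' : d₁ 0 = 0) {x : ℝ} (hx : x ∈ Icc (0 : ℝ) 1) :
    ‖d x‖ * |lam.im| ≤ Real.exp (K ^ 2 + 2 * K + 2 * A * (K + 1) + 1) * G := by
  set τ := |lam.im| with hτ
  set B := K ^ 2 + 2 * K + 2 * A * (K + 1) with hB
  have hB0 : 0 ≤ B := by positivity
  have hG0 : 0 ≤ G := (norm_nonneg _).trans (hG (1 / 2) (by norm_num))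
  -- In the strip `lam² = -τ² + O(τ)`, so `d` behaves like an oscillator of frequency `τ`. With the
  -- weight `τ²` the terms of order `τ²` cancel in the derivative of this energy.
  set E : ℝ → ℝ := fun x => ‖d₁ x‖ ^ 2 + τ ^ 2 * ‖d x‖ ^ 2 with hE
  have hlam : ‖lam‖ ≤ K + τ := (Complex.norm_le_abs_re_add_abs_im lam).trans (by linarith)
  have hsq : ‖lam ^ 2 + (τ : ℂ) ^ 2‖ ≤ K ^ 2 + 2 * K * τ := by
    have : lam ^ 2 + (τ : ℂ) ^ 2 = (lam.re : ℂ) ^ 2 + 2 * lam.re * lam.im * Complex.I := by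
      rw [hτ]
      norm_cast
      rw [sq_abs]
      apply Complex.ext <;> simp [pow_two]; ring
    rw [this]
    refine (norm_add_le _ _).trans ?_
    simp only [norm_pow, norm_mul, Complex.norm_real, Real.norm_eq_abs, Complex.norm_I, mul_one,
      Complex.norm_ofNat]
    gcongr
  have hder : ∀ x ∈ Ioo (0 : ℝ) 1, HasDerivAt E
      (2 * inner ℝ (d₁ x) (d₂ x) + τ ^ 2 * (2 * inner ℝ (d x) (d₁ x))) x := fun x hx =>
    (hd₁' x hx).norm_sq.add ((hd' x hx).norm_sq.const_mul _)
  have hle : ∀ x ∈ Ioo (0 : ℝ) 1,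
      2 * inner ℝ (d₁ x) (d₂ x) + τ ^ 2 * (2 * inner ℝ (d x) (d₁ x)) ≤ (B + 1) * E x + G ^ 2 := by
    intro x hx
    have hxI := Ioo_subset_Icc_self hx
    set h := d₂ x + ((τ ^ 2 : ℝ)) • d x with hh
    have hhn : ‖h‖ ≤ B * τ * ‖d x‖ + G := by
      have : h = (d₂ x - (lam ^ 2 + 2 * lam * (a x : ℂ)) * d x) +
          (lam ^ 2 + (τ : ℂ) ^ 2 + 2 * lam * (a x : ℂ)) * d x := by
        rw [hh, Complex.real_smul]; push_cast; ring
      rw [this]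
      refine (norm_add_le _ _).trans ?_
      rw [norm_mul, add_comm]
      gcongr ?_ * _ + ?_
      · refine (norm_add_le _ _).trans ?_
        have h2 : ‖2 * lam * (a x : ℂ)‖ ≤ 2 * (K + τ) * A := by
          simp only [norm_mul, Complex.norm_real, Real.norm_eq_abs, Complex.norm_ofNat]
          gcongr
          exact ha x hxI
        nlinarith [mul_nonneg (sq_nonneg K) (sub_nonneg.2 him),
          mul_nonneg (mul_nonneg hA hK) (sub_nonneg.2 him)]
      · exact hG x hx
    have hd2 : d₂ x = h - ((τ ^ 2 : ℝ)) • d x := by simp [hh]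
    rw [hd2, inner_sub_right, inner_smul_right, real_inner_comm (d₁ x) (d x)]
    have h1 : inner ℝ (d₁ x) h ≤ ‖d₁ x‖ * (B * τ * ‖d x‖ + G) :=
      (real_inner_le_norm _ _).trans (by gcongr)
    simp only [hE]
    nlinarith [mul_nonneg hB0 (sq_nonneg (‖d₁ x‖ - τ * ‖d x‖)), sq_nonneg (‖d₁ x‖ - G),
      mul_nonneg (sq_nonneg τ) (sq_nonneg ‖d x‖)]
  have hEc : ContinuousOn E (Icc 0 1) :=
    (hd₁.norm.pow 2).add ((hd.norm.pow 2).const_smul (τ ^ 2))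
  -- Grönwall's argument for `E' ≤ (B + 1) E + G²`, with the integrating factor bounded by `1` in
  -- front of `G²`.
  have hanti : AntitoneOn (fun x => Real.exp (-(B + 1) * x) * E x - G ^ 2 * x) (Icc 0 1) := by
    have hder' : ∀ x ∈ Ioo (0 : ℝ) 1,
        HasDerivAt (fun x => Real.exp (-(B + 1) * x) * E x - G ^ 2 * x)
          (Real.exp (-(B + 1) * x) * (-(B + 1) * 1) * E x + Real.exp (-(B + 1) * x) *
          (2 * inner ℝ (d₁ x) (d₂ x) + τ ^ 2 * (2 * inner ℝ (d x) (d₁ x))) - G ^ 2 * 1) x :=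
      fun x hx => (((((hasDerivAt_id x).const_mul (-(B + 1))).exp).mul (hder x hx))).sub
        ((hasDerivAt_id x).const_mul _)
    refine antitoneOn_of_deriv_nonpos (convex_Icc 0 1) ?_ ?_ ?_
    · fun_prop
    · rw [interior_Icc]
      exact fun x hx => (hder' x hx).differentiableAt.differentiableWithinAt
    · rw [interior_Icc]
      intro x hx
      rw [(hder' x hx).deriv]
      have he : Real.exp (-(B + 1) * x) ≤ 1 := by
        rw [Real.exp_le_one_iff]; nlinarith [hx.1]
      have he0 := (Real.exp_pos (-(B + 1) * x)).le
      nlinarith [mul_le_mul_of_nonneg_left (hle x hx) he0, mul_nonneg (sq_nonneg G) (sub_nonneg.2 he)]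
  have hfin := hanti (left_mem_Icc.2 zero_le_one) hx hx.1
  have hE0 : E 0 = 0 := by simp [hE, h0, h0']
  simp only [hE0, mul_zero, sub_zero, sub_nonpos] at hfin
  have hEx : E x ≤ Real.exp (B + 1) * G ^ 2 := by
    have h1 : E x = Real.exp ((B + 1) * x) * (Real.exp (-(B + 1) * x) * E x) := by
      rw [← mul_assoc, ← Real.exp_add, show (B + 1) * x + -(B + 1) * x = 0 by ring]; simp
    rw [h1]
    have h2 : Real.exp (-(B + 1) * x) * E x ≤ G ^ 2 := by nlinarith [hx.2, sq_nonneg G]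
    have h3 : Real.exp ((B + 1) * x) ≤ Real.exp (B + 1) := by
      rw [Real.exp_le_exp]; nlinarith [hx.2]
    have h4 : 0 ≤ Real.exp (-(B + 1) * x) * E x := by positivity
    gcongr
  have h1 : 1 ≤ Real.exp (B + 1) := Real.one_le_exp (by positivity)
  refine (pow_le_pow_iff_left₀ (by positivity) (by positivity) two_ne_zero).1 ?_
  have : (‖d x‖ * τ) ^ 2 ≤ E x := by simp only [hE]; nlinarith [sq_nonneg ‖d₁ x‖]
  nlinarith [mul_nonneg (sub_nonneg.2 h1) (mul_nonneg (Real.exp_pos (B + 1)).le (sq_nonneg G))]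

/-! ### Power series in the spectral parameter -/

/-- Right-hand sides of the recursion for the coefficients, in powers of the spectral parameter, of
the solution of `u'' = (lam² + 2 lam α) u`, `u 0 = 0`, `u' 0 = 1`. -/
noncomputable def powerCoeffForce (α : ℝ → ℝ) (c : ℕ → ℝ → ℝ) : ℕ → ℝ → ℝ
  | 0 => fun _ => 0
  | 1 => fun t => 2 * α t * c 0 t
  | n + 2 => fun t => c n t + 2 * α t * c (n + 1) t

/-- The coefficients, in powers of the spectral parameter, of
the solution of `u'' = (lam² + 2 lam α) u`, `u 0 = 0`, `u' 0 = 1`. -/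
noncomputable def powerCoeff (α : ℝ → ℝ) : ℕ → ℝ → ℝ
  | 0 => fun x => x
  | 1 => fun x => ∫ s in (0 : ℝ)..x, ∫ t in (0 : ℝ)..s, 2 * α t * t
  | n + 2 => fun x => ∫ s in (0 : ℝ)..x, ∫ t in (0 : ℝ)..s,
      (powerCoeff α n t + 2 * α t * powerCoeff α (n + 1) t)

noncomputable def powerCoeffSlope (α : ℝ → ℝ) (n : ℕ) (x : ℝ) : ℝ :=
  (if n = 0 then 1 else 0) + ∫ t in (0 : ℝ)..x, powerCoeffForce α (powerCoeff α) n t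

theorem powerCoeff_eq_integral_slope (α : ℝ → ℝ) (n : ℕ) (x : ℝ) :
    powerCoeff α n x = ∫ t in (0 : ℝ)..x, powerCoeffSlope α n t := by
  match n with
  | 0 => simp [powerCoeff, powerCoeffSlope, powerCoeffForce]
  | 1 => simp [powerCoeff, powerCoeffSlope, powerCoeffForce]
  | n + 2 => simp [powerCoeff, powerCoeffSlope, powerCoeffForce]

theorem hasDerivAt_integral_of_continuous {f : ℝ → ℝ} (hf : Continuous f) (x : ℝ) :
    HasDerivAt (fun x => ∫ t in (0 : ℝ)..x, f t) (f x) x :=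
  integral_hasDerivAt_right (hf.intervalIntegrable _ _) (hf.stronglyMeasurableAtFilter _ _)
    hf.continuousAt

theorem continuous_integral_of_continuous {f : ℝ → ℝ} (hf : Continuous f) :
    Continuous (fun x => ∫ t in (0 : ℝ)..x, f t) :=
  continuous_iff_continuousAt.2 fun x => (hasDerivAt_integral_of_continuous hf x).continuousAt

theorem continuous_powerCoeff {α : ℝ → ℝ} (hα : Continuous α) (n : ℕ) : Continuous (powerCoeff α n) := by
  induction n using Nat.twoStepInduction with
  | zero => exact continuous_id
  | one =>
    refine continuous_integral_of_continuous (continuous_integral_of_continuous ?_)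
    fun_prop
  | more n h0 h1 =>
    refine continuous_integral_of_continuous (continuous_integral_of_continuous ?_)
    fun_prop

theorem continuous_powerCoeffForce {α : ℝ → ℝ} (hα : Continuous α) (n : ℕ) :
    Continuous (powerCoeffForce α (powerCoeff α) n) := by
  have h := continuous_powerCoeff hα
  match n with
  | 0 => exact continuous_const
  | 1 => have := h 0; simp only [powerCoeffForce]; fun_prop
  | n + 2 => have := h n; have := h (n + 1); simp only [powerCoeffForce]; fun_prop

theorem hasDerivAt_powerCoeffSlope {α : ℝ → ℝ} (hα : Continuous α) (n : ℕ) (x : ℝ) :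
    HasDerivAt (powerCoeffSlope α n) (powerCoeffForce α (powerCoeff α) n x) x :=
  (hasDerivAt_integral_of_continuous (continuous_powerCoeffForce hα n) x).const_add _

theorem continuous_powerCoeffSlope {α : ℝ → ℝ} (hα : Continuous α) (n : ℕ) : Continuous (powerCoeffSlope α n) :=
  continuous_iff_continuousAt.2 fun x => (hasDerivAt_powerCoeffSlope hα n x).continuousAt

theorem hasDerivAt_powerCoeff {α : ℝ → ℝ} (hα : Continuous α) (n : ℕ) (x : ℝ) :
    HasDerivAt (powerCoeff α n) (powerCoeffSlope α n x) x := by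
  rw [show powerCoeff α n = _ from funext (powerCoeff_eq_integral_slope α n)]
  exact hasDerivAt_integral_of_continuous (continuous_powerCoeffSlope hα n) x

theorem abs_integral_le_pow {f : ℝ → ℝ} (hf : Continuous f) {C : ℝ} {n : ℕ}
    (h : ∀ t ∈ Icc (0 : ℝ) 2, |f t| ≤ C * (t ^ n / n.factorial)) {x : ℝ}
    (hx : x ∈ Icc (0 : ℝ) 2) :
    |∫ t in (0 : ℝ)..x, f t| ≤ C * (x ^ (n + 1) / (n + 1).factorial) := by
  refine (abs_integral_le_integral_abs hx.1).trans ?_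
  have h1 : ∫ t in (0 : ℝ)..x, |f t| ≤ ∫ t in (0 : ℝ)..x, C * (t ^ n / n.factorial) := by
    refine integral_mono_on hx.1 (hf.abs.intervalIntegrable _ _)
      (Continuous.intervalIntegrable (by fun_prop) _ _) fun t ht => h t ⟨ht.1, ht.2.trans hx.2⟩
  refine h1.trans (le_of_eq ?_)
  rw [integral_const_mul, integral_div, integral_pow, Nat.factorial_succ]
  push_cast
  field_simp
  simp

theorem exists_summable_bound_powerCoeff {α : ℝ → ℝ} (hα : Continuous α) :
    ∃ b : ℕ → ℝ, (∀ r : ℝ, Summable fun n => r ^ n * b n) ∧ ∀ n, ∀ x ∈ Icc (0 : ℝ) 2,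
      |powerCoeff α n x| ≤ b n ∧ |powerCoeffSlope α n x| ≤ b n ∧
        |powerCoeffForce α (powerCoeff α) n x| ≤ b n := by
  obtain ⟨A, hA⟩ := (isCompact_Icc (a := (0 : ℝ)) (b := 2)).exists_bound_of_continuousOn
    hα.continuousOn
  simp only [Real.norm_eq_abs] at hA
  have hA0 : 0 ≤ A := (abs_nonneg _).trans (hA 0 (by norm_num))
  -- This choice gives `1 + 4 A M ≤ M²`, which closes the induction for `|c n x| ≤ 2 M ^ n x ^ n /
  -- n!`.
  set M := 1 + 4 * A with hM
  have hM1 : 1 ≤ M := by linarith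
  have hforce1 : ∀ x ∈ Icc (0 : ℝ) 2, |powerCoeffForce α (powerCoeff α) 1 x| ≤
      4 * A * (x ^ 0 / (Nat.factorial 0)) := by
    intro x hx
    simp only [powerCoeffForce, powerCoeff, abs_mul, abs_two, abs_of_nonneg hx.1]
    have := hA x hx
    have := hx.1
    have := hx.2
    have : |α x| * x ≤ A * 2 := by gcongr
    norm_num
    linarith
  have hcont := continuous_powerCoeffForce hα
  have hslope1 : ∀ x ∈ Icc (0 : ℝ) 2, |powerCoeffSlope α 1 x| ≤
      4 * A * (x ^ 1 / (Nat.factorial 1)) := by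
    intro x hx
    simpa [powerCoeffSlope] using abs_integral_le_pow (hcont 1) hforce1 hx
  have hc1 : ∀ x ∈ Icc (0 : ℝ) 2, |powerCoeff α 1 x| ≤ 4 * A * (x ^ 2 / (Nat.factorial 2)) := by
    intro x hx
    rw [powerCoeff_eq_integral_slope]
    exact abs_integral_le_pow (continuous_powerCoeffSlope hα 1) hslope1 hx
  have hstep : ∀ n : ℕ,
      (∀ x ∈ Icc (0 : ℝ) 2, |powerCoeff α n x| ≤ 2 * M ^ n * (x ^ n / n.factorial)) →
      (∀ x ∈ Icc (0 : ℝ) 2,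
        |powerCoeff α (n + 1) x| ≤ 2 * M ^ (n + 1) * (x ^ (n + 1) / (n + 1).factorial)) →
      ∀ x ∈ Icc (0 : ℝ) 2, |powerCoeffForce α (powerCoeff α) (n + 2) x| ≤
        2 * M ^ (n + 2) * (x ^ n / n.factorial) := by
    intro n h0 h1 x hx
    have hx0 := hx.1
    -- One surplus power of `x` is traded for a factor `2`, so that both terms of the force carry `x
    -- ^ n / n!`. Two integrations then restore the degree `n + 2`.
    have hxf : x ^ (n + 1) / (n + 1).factorial ≤ 2 * (x ^ n / n.factorial) := by
      rw [Nat.factorial_succ]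
      push_cast
      rw [pow_succ, mul_comm ((n : ℝ) + 1), ← div_mul_div_comm, mul_comm]
      gcongr
      exact (div_le_self hx0 (by linarith [(Nat.cast_nonneg n : (0 : ℝ) ≤ n)])).trans hx.2
    have hpos : 0 ≤ x ^ n / n.factorial := by positivity
    have hk : |2 * α x * powerCoeff α (n + 1) x| ≤
        2 * A * (2 * M ^ (n + 1) * (2 * (x ^ n / n.factorial))) := by
      rw [abs_mul, abs_mul, abs_two]
      gcongr
      · exact hA x hx
      · exact (h1 x hx).trans (by gcongr)
    have hfin : 2 * M ^ n * (x ^ n / n.factorial) +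
        2 * A * (2 * M ^ (n + 1) * (2 * (x ^ n / n.factorial))) ≤
        2 * M ^ (n + 2) * (x ^ n / n.factorial) := by
      have : 1 + 4 * A * M ≤ M ^ 2 := by nlinarith
      have hq : 0 ≤ 2 * M ^ n * (x ^ n / n.factorial) := by positivity
      calc _ = 2 * M ^ n * (x ^ n / n.factorial) * (1 + 4 * A * M) := by ring
        _ ≤ 2 * M ^ n * (x ^ n / n.factorial) * M ^ 2 := by gcongr
        _ = _ := by ring
    exact (abs_add_le _ _).trans ((add_le_add (h0 x hx) hk).trans hfin)
  have hslope : ∀ n : ℕ, (∀ x ∈ Icc (0 : ℝ) 2, |powerCoeffForce α (powerCoeff α) (n + 2) x| ≤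
        2 * M ^ (n + 2) * (x ^ n / n.factorial)) → ∀ x ∈ Icc (0 : ℝ) 2,
        |powerCoeffSlope α (n + 2) x| ≤ 2 * M ^ (n + 2) * (x ^ (n + 1) / (n + 1).factorial) := by
    intro n h x hx
    simpa [powerCoeffSlope] using abs_integral_le_pow (hcont (n + 2)) h hx
  have hcoeff : ∀ n : ℕ, ∀ x ∈ Icc (0 : ℝ) 2,
      |powerCoeff α n x| ≤ 2 * M ^ n * (x ^ n / n.factorial) := by
    intro n
    induction n using Nat.twoStepInduction with
    | zero =>
      intro x hx
      simpa [powerCoeff, abs_of_nonneg hx.1] using hx.2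
    | one =>
      intro x hx
      refine (hc1 x hx).trans ?_
      norm_num [Nat.factorial]
      nlinarith [hx.1, hx.2, mul_nonneg hA0 (mul_nonneg hx.1 (sub_nonneg.2 hx.2)),
        mul_nonneg hA0 hx.1]
    | more n h0 h1 =>
      intro x hx
      rw [powerCoeff_eq_integral_slope]
      exact abs_integral_le_pow (continuous_powerCoeffSlope hα _)
        (hslope n (hstep n h0 h1)) hx
  refine ⟨fun n => match n with
    | 0 => 2
    | 1 => 8 * M
    | n + 2 => 8 * M ^ (n + 2) * (2 ^ n / n.factorial), fun r => ?_, fun n x hx => ?_⟩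
  · refine (summable_nat_add_iff 2).1 ?_
    refine ((Real.summable_pow_div_factorial (2 * M * r)).mul_left (8 * M ^ 2 * r ^ 2)).congr ?_
    intro n
    simp only [mul_pow, pow_add]
    ring
  · have hx0 := hx.1
    have hx2 := hx.2
    match n with
    | 0 => simpa [powerCoeff, powerCoeffSlope, powerCoeffForce, abs_of_nonneg hx0] using hx2
    | 1 =>
      simp only
      refine ⟨(hc1 x hx).trans ?_, (hslope1 x hx).trans ?_, (hforce1 x hx).trans ?_⟩ <;>
        norm_num [Nat.factorial] <;> nlinarith [mul_nonneg hA0 (sub_nonneg.2 hx2),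
          mul_nonneg hA0 (mul_nonneg hx0 (sub_nonneg.2 hx2)), mul_nonneg hA0 hx0]
    | n + 2 =>
      simp only
      have hF := hstep n (hcoeff n) (hcoeff (n + 1))
      have key : ∀ k : ℕ, k ≤ 2 → 2 * M ^ (n + 2) * (x ^ (n + k) / (n + k).factorial) ≤
          8 * M ^ (n + 2) * (2 ^ n / n.factorial) := by
        intro k hk
        have h1 : x ^ (n + k) / ((n + k).factorial : ℝ) ≤ 4 * (2 ^ n / n.factorial) := by
          have hf : (n.factorial : ℝ) ≤ (n + k).factorial := by
            exact_mod_cast Nat.factorial_le (Nat.le_add_right n k)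
          calc x ^ (n + k) / ((n + k).factorial : ℝ) ≤ 2 ^ (n + k) / n.factorial := by gcongr
            _ ≤ 2 ^ (n + 2) / n.factorial := by gcongr; norm_num
            _ = _ := by ring
        calc _ ≤ 2 * M ^ (n + 2) * (4 * (2 ^ n / n.factorial)) := by gcongr
          _ = _ := by ring
      exact ⟨(hcoeff _ x hx).trans (key 2 le_rfl), (hslope n hF x hx).trans (key 1 one_le_two),
        (hF x hx).trans (key 0 zero_le_two)⟩

/-- The solution with data `w 0 = 0`, `w' 0 = 1` exists for every spectral parameter and depends
holomorphically on it. -/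
theorem exists_holomorphic_solution {α : ℝ → ℝ} (hα : Continuous α) :
    ∃ w w₁ : ℂ → ℝ → ℂ, (∀ lam, w lam 0 = 0) ∧ (∀ lam, w₁ lam 0 = 1) ∧
      (∀ lam, ContinuousOn (w lam) (Icc 0 1)) ∧ (∀ lam, ContinuousOn (w₁ lam) (Icc 0 1)) ∧
      (∀ lam, ∀ x ∈ Ioo (0 : ℝ) 2, HasDerivAt (w lam) (w₁ lam x) x) ∧
      (∀ lam, ∀ x ∈ Ioo (0 : ℝ) 2,
        HasDerivAt (w₁ lam) ((lam ^ 2 + 2 * lam * (α x : ℂ)) * w lam x) x) ∧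
      Differentiable ℂ fun lam => w lam 1 := by
  obtain ⟨b, hbs, hb⟩ := exists_summable_bound_powerCoeff hα
  have hb0 : ∀ n, 0 ≤ b n := fun n => (abs_nonneg _).trans (hb n 0 (by norm_num)).1
  have hnorm : ∀ (lam : ℂ) (n : ℕ) (y : ℝ), |y| ≤ b n → ‖lam ^ n * (y : ℂ)‖ ≤ ‖lam‖ ^ n * b n := by
    intro lam n y hy
    rw [norm_mul, norm_pow, Complex.norm_real, Real.norm_eq_abs]
    gcongr
  have hI : Icc (0 : ℝ) 1 ⊆ Icc 0 2 := Icc_subset_Icc_right one_le_two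
  have hsum : ∀ (lam : ℂ), ∀ x ∈ Icc (0 : ℝ) 2,
      Summable fun n => lam ^ n * (powerCoeff α n x : ℂ) := fun lam x hx =>
    .of_norm_bounded (hbs ‖lam‖) fun n => hnorm lam n _ (hb n x hx).1
  have hsum₁ : ∀ (lam : ℂ), ∀ x ∈ Icc (0 : ℝ) 2,
      Summable fun n => lam ^ n * (powerCoeffSlope α n x : ℂ) := fun lam x hx =>
    .of_norm_bounded (hbs ‖lam‖) fun n => hnorm lam n _ (hb n x hx).2.1
  have hsum₂ : ∀ (lam : ℂ), ∀ x ∈ Icc (0 : ℝ) 2,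
      Summable fun n => lam ^ n * (powerCoeffForce α (powerCoeff α) n x : ℂ) := fun lam x hx =>
    .of_norm_bounded (hbs ‖lam‖) fun n => hnorm lam n _ (hb n x hx).2.2
  refine ⟨fun lam x => ∑' n, lam ^ n * (powerCoeff α n x : ℂ),
    fun lam x => ∑' n, lam ^ n * (powerCoeffSlope α n x : ℂ), ?_, ?_, ?_, ?_, ?_, ?_, ?_⟩
  · intro lam
    simp [powerCoeff_eq_integral_slope]
  · intro lam
    simp only [powerCoeffSlope, integral_same, add_zero]
    rw [tsum_eq_single 0 (by intro n hn; simp [hn])]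
    simp
  · intro lam
    refine continuousOn_tsum (fun n => ?_) (hbs ‖lam‖) fun n x hx => hnorm lam n _ (hb n x (hI hx)).1
    have := continuous_powerCoeff hα n
    fun_prop
  · intro lam
    refine continuousOn_tsum (fun n => ?_) (hbs ‖lam‖)
      fun n x hx => hnorm lam n _ (hb n x (hI hx)).2.1
    have := continuous_powerCoeffSlope hα n
    fun_prop
  · intro lam x hx
    exact hasDerivAt_tsum_of_isPreconnected (hbs ‖lam‖) isOpen_Ioo isPreconnected_Ioo
      (fun n y _ => ((hasDerivAt_powerCoeff hα n y).ofReal_comp).const_mul _)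
      (fun n y hy => hnorm lam n _ (hb n y (Ioo_subset_Icc_self hy)).2.1) hx
      (hsum lam x (Ioo_subset_Icc_self hx)) hx
  · intro lam x hx
    have hxI := Ioo_subset_Icc_self hx
    have h := hasDerivAt_tsum_of_isPreconnected (hbs ‖lam‖) isOpen_Ioo isPreconnected_Ioo
      (fun n y _ => ((hasDerivAt_powerCoeffSlope hα n y).ofReal_comp).const_mul (lam ^ n))
      (fun n y hy => hnorm lam n _ (hb n y (Ioo_subset_Icc_self hy)).2.2) hx
      (hsum₁ lam x hxI) hx
    -- After the terms of index `0` and `1` are split off, the recursion matches the series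
    -- coefficientwise.
    refine h.congr_deriv (Eq.symm ?_)
    beta_reduce
    have hs := hsum lam x hxI
    have hs' := (summable_nat_add_iff 1).2 hs
    have hF := hsum₂ lam x hxI
    rw [hF.tsum_eq_zero_add, ((summable_nat_add_iff 1).2 hF).tsum_eq_zero_add, add_mul,
      mul_assoc 2 lam]
    conv_lhs => arg 2; rw [hs.tsum_eq_zero_add]
    have h2 : ∑' n, lam ^ (n + 1 + 1) * (powerCoeffForce α (powerCoeff α) (n + 1 + 1) x : ℂ) =
        lam ^ 2 * ∑' n, lam ^ n * (powerCoeff α n x : ℂ) +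
        2 * lam * α x * ∑' n, lam ^ (n + 1) * (powerCoeff α (n + 1) x : ℂ) := by
      rw [← tsum_mul_left, ← tsum_mul_left, ← (hs.mul_left _).tsum_add (hs'.mul_left _)]
      congr 1 with n
      simp only [powerCoeffForce]
      push_cast
      ring
    rw [h2]
    simp only [powerCoeffForce]
    push_cast
    ring
  · intro lam
    have h := Complex.differentiableOn_tsum_of_summable_norm (U := Metric.ball 0 (‖lam‖ + 1))
      (F := fun n (z : ℂ) => z ^ n * (powerCoeff α n 1 : ℂ)) (hbs (‖lam‖ + 1))
      (fun n => by fun_prop) Metric.isOpen_ball (fun n z hz => by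
        refine (hnorm z n _ (hb n 1 (by norm_num)).1).trans ?_
        have := hb0 n
        have : ‖z‖ ≤ ‖lam‖ + 1 := (mem_ball_zero_iff.1 hz).le
        gcongr)
    exact h.differentiableAt (Metric.isOpen_ball.mem_nhds (by simp))

/-! ### WKB approximation through the Riccati equation -/

/-- Fixed by the order `μ⁰` of the Riccati equation: `α' + α² + 2 c₁ = 0`. -/
noncomputable def wkbCoeff₁ (α : ℝ → ℝ) (x : ℝ) : ℝ := -(deriv α x + α x ^ 2) / 2

/-- Fixed by the order `μ⁻¹`: `c₁' + 2 α c₁ + 2 c₂ = 0`. The residual involves `c₂'`, hence three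
derivatives of `α`. -/
noncomputable def wkbCoeff₂ (α : ℝ → ℝ) (x : ℝ) : ℝ :=
  deriv (deriv α) x / 4 + α x * deriv α x + α x ^ 3 / 2

/-- Truncated expansion in powers of `1 / μ` of a solution of the Riccati equation
`φ' + φ² = μ² + 2 μ α`. -/
noncomputable def wkbSlope (μ : ℂ) (α : ℝ → ℝ) (x : ℝ) : ℂ :=
  μ + α x + wkbCoeff₁ α x / μ + wkbCoeff₂ α x / μ ^ 2

noncomputable def wkbPhase (μ : ℂ) (α : ℝ → ℝ) (x : ℝ) : ℂ :=
  μ * x + (∫ t in (0 : ℝ)..x, α t : ℝ) + (∫ t in (0 : ℝ)..x, wkbCoeff₁ α t : ℝ) / μ +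
    (∫ t in (0 : ℝ)..x, wkbCoeff₂ α t : ℝ) / μ ^ 2

/-- The defect of `wkbSlope` in the Riccati equation. -/
noncomputable def wkbResidual (μ : ℂ) (α : ℝ → ℝ) (x : ℝ) : ℂ :=
  (deriv (wkbCoeff₂ α) x + 2 * α x * wkbCoeff₂ α x + wkbCoeff₁ α x ^ 2) / μ ^ 2 +
    2 * wkbCoeff₁ α x * wkbCoeff₂ α x / μ ^ 3 + wkbCoeff₂ α x ^ 2 / μ ^ 4

theorem wkbPhase_zero (μ : ℂ) (α : ℝ → ℝ) : wkbPhase μ α 0 = 0 := by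
  simp [wkbPhase]

theorem contDiff_deriv_of_succ {α : ℝ → ℝ} (n : ℕ) (hα : ContDiff ℝ (n + 1 : ℕ) α) :
    ContDiff ℝ n (deriv α) :=
  (contDiff_succ_iff_deriv.1 (by exact_mod_cast hα : ContDiff ℝ ((n : WithTop ℕ∞) + 1) α)).2.2

theorem contDiff_wkbCoeff₁ {α : ℝ → ℝ} (hα : ContDiff ℝ 3 α) : ContDiff ℝ 1 (wkbCoeff₁ α) := by
  have h1 : ContDiff ℝ 2 (deriv α) := contDiff_deriv_of_succ 2 (by exact_mod_cast hα)
  have h1' : ContDiff ℝ 1 (deriv α) := h1.of_le (by norm_num)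
  have h0 : ContDiff ℝ 1 α := hα.of_le (by norm_num)
  unfold wkbCoeff₁
  fun_prop

theorem contDiff_wkbCoeff₂ {α : ℝ → ℝ} (hα : ContDiff ℝ 3 α) : ContDiff ℝ 1 (wkbCoeff₂ α) := by
  have h1 : ContDiff ℝ 2 (deriv α) := contDiff_deriv_of_succ 2 (by exact_mod_cast hα)
  have h2 : ContDiff ℝ 1 (deriv (deriv α)) := contDiff_deriv_of_succ 1 (by exact_mod_cast h1)
  have h1' : ContDiff ℝ 1 (deriv α) := h1.of_le (by norm_num)
  have h0 : ContDiff ℝ 1 α := hα.of_le (by norm_num)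
  unfold wkbCoeff₂
  fun_prop

theorem hasDerivAt_wkbCoeff₁ {α : ℝ → ℝ} (hα : ContDiff ℝ 3 α) (x : ℝ) :
    HasDerivAt (wkbCoeff₁ α) (-2 * wkbCoeff₂ α x - 2 * α x * wkbCoeff₁ α x) x := by
  have h1 : ContDiff ℝ 2 (deriv α) := contDiff_deriv_of_succ 2 (by exact_mod_cast hα)
  have hd : HasDerivAt α (deriv α x) x := (hα.differentiable (by norm_num) x).hasDerivAt
  have hd1 : HasDerivAt (deriv α) (deriv (deriv α) x) x :=
    (h1.differentiable (by norm_num) x).hasDerivAt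
  refine ((hd1.add (hd.pow 2)).neg.div_const 2).congr_deriv ?_
  simp only [wkbCoeff₁, wkbCoeff₂]
  norm_num
  ring

theorem hasDerivAt_wkbSlope {α : ℝ → ℝ} (hα : ContDiff ℝ 3 α) {μ : ℂ} (hμ : μ ≠ 0) (x : ℝ) :
    HasDerivAt (wkbSlope μ α)
      (μ ^ 2 + 2 * μ * α x + wkbResidual μ α x - wkbSlope μ α x ^ 2) x := by
  have hd : HasDerivAt α (deriv α x) x := (hα.differentiable (by norm_num) x).hasDerivAt
  have h2 : HasDerivAt (wkbCoeff₂ α) (deriv (wkbCoeff₂ α) x) x :=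
    ((contDiff_wkbCoeff₂ hα).differentiable (by norm_num) x).hasDerivAt
  refine (((hd.ofReal_comp.const_add μ).add
    ((hasDerivAt_wkbCoeff₁ hα x).ofReal_comp.div_const μ)).add
      (h2.ofReal_comp.div_const (μ ^ 2))).congr_deriv ?_
  have hα1 : deriv α x = -2 * wkbCoeff₁ α x - α x ^ 2 := by simp only [wkbCoeff₁]; ring
  rw [hα1]
  simp only [wkbResidual, wkbSlope]
  push_cast
  field_simp
  ring

theorem hasDerivAt_wkbPhase {α : ℝ → ℝ} (hα : ContDiff ℝ 3 α) (μ : ℂ) (x : ℝ) :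
    HasDerivAt (wkbPhase μ α) (wkbSlope μ α x) x := by
  have hx : HasDerivAt (fun x : ℝ => μ * (x : ℂ)) (μ * 1) x :=
    (hasDerivAt_id x).ofReal_comp.const_mul μ
  refine (((hx.add (hasDerivAt_integral_of_continuous hα.continuous x).ofReal_comp).add
    ((hasDerivAt_integral_of_continuous (contDiff_wkbCoeff₁ hα).continuous x).ofReal_comp.div_const
      μ)).add ((hasDerivAt_integral_of_continuous
        (contDiff_wkbCoeff₂ hα).continuous x).ofReal_comp.div_const (μ ^ 2))).congr_deriv ?_
  simp [wkbSlope]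

theorem hasDerivAt_exp_wkbPhase {α : ℝ → ℝ} (hα : ContDiff ℝ 3 α) (μ : ℂ) (x : ℝ) :
    HasDerivAt (fun x => Complex.exp (wkbPhase μ α x))
      (wkbSlope μ α x * Complex.exp (wkbPhase μ α x)) x := by
  refine (hasDerivAt_wkbPhase hα μ x).cexp.congr_deriv ?_
  ring

theorem hasDerivAt_wkbSlope_mul_exp {α : ℝ → ℝ} (hα : ContDiff ℝ 3 α) {μ : ℂ} (hμ : μ ≠ 0)
    (x : ℝ) :
    HasDerivAt (fun x => wkbSlope μ α x * Complex.exp (wkbPhase μ α x))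
      ((μ ^ 2 + 2 * μ * α x + wkbResidual μ α x) * Complex.exp (wkbPhase μ α x)) x := by
  refine ((hasDerivAt_wkbSlope hα hμ x).mul (hasDerivAt_exp_wkbPhase hα μ x)).congr_deriv ?_
  ring

theorem exists_abs_le_of_continuous {f : ℝ → ℝ} (hf : Continuous f) :
    ∃ C, 0 ≤ C ∧ ∀ x ∈ Icc (0 : ℝ) 1, |f x| ≤ C := by
  obtain ⟨C, hC⟩ := (isCompact_Icc (a := (0 : ℝ)) (b := 1)).exists_bound_of_continuousOn
    hf.continuousOn
  exact ⟨C, (abs_nonneg _).trans (hC 0 (by norm_num)), hC⟩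

theorem norm_div_pow_le {μ z : ℂ} {C : ℝ} {n m : ℕ} (hμ : 1 ≤ ‖μ‖) (hnm : m ≤ n) (hz : ‖z‖ ≤ C) :
    ‖z / μ ^ n‖ ≤ C / ‖μ‖ ^ m := by
  rw [norm_div, norm_pow]
  have := norm_nonneg z
  gcongr
  exact (norm_nonneg _).trans hz

/-- Uniform bounds in vertical strips for the phase correction, the approximate solution and the
residual. -/
theorem exists_wkb_bound {α : ℝ → ℝ} (hα : ContDiff ℝ 3 α) (K : ℝ) :
    ∃ C, 0 ≤ C ∧ ∀ μ : ℂ, 1 ≤ ‖μ‖ → |μ.re| ≤ K → ∀ x ∈ Icc (0 : ℝ) 1,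
      ‖wkbPhase μ α x - (μ * x + (∫ t in (0 : ℝ)..x, α t : ℝ))‖ ≤ C / ‖μ‖ ∧
      ‖Complex.exp (wkbPhase μ α x)‖ ≤ C ∧ ‖wkbResidual μ α x‖ ≤ C / ‖μ‖ ^ 2 := by
  have c0 := hα.continuous
  have c1 := (contDiff_wkbCoeff₁ hα).continuous
  have c2 := (contDiff_wkbCoeff₂ hα).continuous
  have c3 : Continuous (deriv (wkbCoeff₂ α)) := (contDiff_wkbCoeff₂ hα).continuous_deriv_one
  obtain ⟨I0, hI0, hI0'⟩ := exists_abs_le_of_continuous (continuous_integral_of_continuous c0)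
  obtain ⟨I1, hI1, hI1'⟩ := exists_abs_le_of_continuous (continuous_integral_of_continuous c1)
  obtain ⟨I2, hI2, hI2'⟩ := exists_abs_le_of_continuous (continuous_integral_of_continuous c2)
  obtain ⟨R0, hR0, hR0'⟩ := exists_abs_le_of_continuous (f := fun x =>
    deriv (wkbCoeff₂ α) x + 2 * α x * wkbCoeff₂ α x + wkbCoeff₁ α x ^ 2) (by fun_prop)
  obtain ⟨R1, hR1, hR1'⟩ := exists_abs_le_of_continuous (f := fun x =>
    2 * wkbCoeff₁ α x * wkbCoeff₂ α x) (by fun_prop)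
  obtain ⟨R2, hR2, hR2'⟩ := exists_abs_le_of_continuous (f := fun x =>
    wkbCoeff₂ α x ^ 2) (by fun_prop)
  set c := I1 + I2 + Real.exp (K + I0 + I1 + I2) + R0 + R1 + R2 with hc
  have he := Real.exp_pos (K + I0 + I1 + I2)
  refine ⟨c, by positivity, fun μ hμ hre x hx => ?_⟩
  have hcorr : ‖wkbPhase μ α x - (μ * x + (∫ t in (0 : ℝ)..x, α t : ℝ))‖ ≤ (I1 + I2) / ‖μ‖ ^ 1 := by
    have : wkbPhase μ α x - (μ * x + (∫ t in (0 : ℝ)..x, α t : ℝ)) =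
        (∫ t in (0 : ℝ)..x, wkbCoeff₁ α t : ℝ) / μ ^ 1 +
        (∫ t in (0 : ℝ)..x, wkbCoeff₂ α t : ℝ) / μ ^ 2 := by
      rw [wkbPhase]; ring
    rw [this, add_div]
    refine (norm_add_le _ _).trans (add_le_add (norm_div_pow_le hμ le_rfl ?_)
      (norm_div_pow_le hμ one_le_two ?_))
    · rw [Complex.norm_real]; exact hI1' x hx
    · rw [Complex.norm_real]; exact hI2' x hx
  refine ⟨?_, ?_, ?_⟩
  · rw [pow_one] at hcorr
    refine hcorr.trans ?_
    gcongr
    linarith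
  · rw [Complex.norm_exp]
    refine le_trans (Real.exp_le_exp.2 ?_) (by linarith : Real.exp (K + I0 + I1 + I2) ≤ c)
    have h1 : (wkbPhase μ α x).re = (wkbPhase μ α x - (μ * x + (∫ t in (0 : ℝ)..x, α t : ℝ))).re +
        μ.re * x + ∫ t in (0 : ℝ)..x, α t := by
      simp
      ring
    rw [h1]
    have h2 := (le_abs_self _).trans ((Complex.abs_re_le_norm _).trans hcorr)
    have h3 : (I1 + I2) / ‖μ‖ ^ 1 ≤ I1 + I2 := div_le_self (by positivity) (by simpa using hμ)
    have h4 := (le_abs_self _).trans (hI0' x hx)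
    have h5 : μ.re * x ≤ K := by
      have := (le_abs_self _).trans hre
      have := (abs_nonneg _).trans hre
      nlinarith [hx.1, hx.2]
    linarith
  · have h0 := norm_div_pow_le (C := R0) (z := (deriv (wkbCoeff₂ α) x + 2 * α x * wkbCoeff₂ α x +
        wkbCoeff₁ α x ^ 2 : ℝ)) hμ (le_refl 2) (by rw [Complex.norm_real]; exact hR0' x hx)
    have h1 := norm_div_pow_le (C := R1) (z := (2 * wkbCoeff₁ α x * wkbCoeff₂ α x : ℝ))
      hμ (by norm_num : 2 ≤ 3) (by rw [Complex.norm_real]; exact hR1' x hx)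
    have h2 := norm_div_pow_le (C := R2) (z := (wkbCoeff₂ α x ^ 2 : ℝ))
      hμ (by norm_num : 2 ≤ 4) (by rw [Complex.norm_real]; exact hR2' x hx)
    push_cast at h0 h1 h2
    have h3 : (R0 + R1 + R2) / ‖μ‖ ^ 2 ≤ c / ‖μ‖ ^ 2 := by
      gcongr
      linarith
    refine le_trans ?_ h3
    rw [add_div, add_div]
    exact (norm_add_le _ _).trans (add_le_add ((norm_add_le _ _).trans (add_le_add h0 h1)) h2)

/-! ### Comparison of exact solutions with the WKB end value -/

/-- The initial slope of the difference of the two approximate solutions. -/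
noncomputable def wkbInitialSlope (lam : ℂ) (α : ℝ → ℝ) : ℂ :=
  wkbSlope lam α 0 - wkbSlope (-lam) (-α) 0

/-- The difference of the two approximate solutions at the right endpoint. -/
noncomputable def wkbEndValue (lam : ℂ) (α : ℝ → ℝ) : ℂ :=
  Complex.exp (wkbPhase lam α 1) - Complex.exp (wkbPhase (-lam) (-α) 1)

theorem norm_le_mul_abs_im {K : ℝ} {lam : ℂ} (hre : |lam.re| ≤ K) (him : 1 ≤ |lam.im|) :
    ‖lam‖ ≤ (K + 1) * |lam.im| := by
  have := Complex.norm_le_abs_re_add_abs_im lam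
  have := (abs_nonneg _).trans hre
  nlinarith

/-- The error has zero initial data and is forced by residual times exponential, of size `O(lam⁻²)`.
The energy estimate gains a factor `|lam.im|`, comparable to `‖lam‖` in the strip. -/
theorem exists_norm_sub_wkbEndValue_le {α : ℝ → ℝ} (hα : ContDiff ℝ 3 α) (K : ℝ) :
    ∃ C, 0 ≤ C ∧ ∀ lam : ℂ, |lam.re| ≤ K → 1 ≤ |lam.im| → ∀ u u₁ : ℝ → ℂ,
      ContinuousOn u (Icc 0 1) → ContinuousOn u₁ (Icc 0 1) →
      (∀ x ∈ Ioo (0 : ℝ) 1, HasDerivAt u (u₁ x) x) →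
      (∀ x ∈ Ioo (0 : ℝ) 1, HasDerivAt u₁ ((lam ^ 2 + 2 * lam * (α x : ℂ)) * u x) x) →
      u 0 = 0 → u₁ 0 = wkbInitialSlope lam α →
      ‖u 1 - wkbEndValue lam α‖ ≤ C / ‖lam‖ ^ 3 := by
  have hα' : ContDiff ℝ 3 (-α) := hα.neg
  obtain ⟨C, hC, hCb⟩ := exists_wkb_bound hα K
  obtain ⟨C', hC', hCb'⟩ := exists_wkb_bound hα' K
  obtain ⟨A, hA, hAb⟩ := exists_abs_le_of_continuous hα.continuous
  set c := Real.exp (K ^ 2 + 2 * K + 2 * A * (K + 1) + 1) with hc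
  have hc0 : 0 < c := Real.exp_pos _
  by_cases hK : 0 ≤ K
  swap
  · exact ⟨0, le_rfl, fun lam hre => absurd ((abs_nonneg _).trans hre) hK⟩
  refine ⟨(K + 1) * (c * (C * C + C' * C')), by positivity,
    fun lam hre him u u₁ hu hu₁ hu' hu₁' h0 h0' => ?_⟩
  have hlam1 : 1 ≤ ‖lam‖ := him.trans (Complex.abs_im_le_norm _)
  have hlam : lam ≠ 0 := norm_pos_iff.1 (by linarith)
  have hVc : ∀ μ β, ContDiff ℝ 3 β → Continuous fun x => Complex.exp (wkbPhase μ β x) :=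
    fun μ β hβ => continuous_iff_continuousAt.2 fun x => (hasDerivAt_exp_wkbPhase hβ μ x).continuousAt
  have hVc₁ : ∀ μ β, μ ≠ 0 → ContDiff ℝ 3 β →
      Continuous fun x => wkbSlope μ β x * Complex.exp (wkbPhase μ β x) :=
    fun μ β hμ hβ => continuous_iff_continuousAt.2 fun x =>
      (hasDerivAt_wkbSlope_mul_exp hβ hμ x).continuousAt
  have key := norm_mul_abs_im_le_of_forced (a := α) (x := 1) (G := (C * C + C' * C') / ‖lam‖ ^ 2)
    hK hA hre him hAb
    (hu.sub ((hVc lam α hα).sub (hVc (-lam) (-α) hα')).continuousOn)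
    (hu₁.sub ((hVc₁ lam α hlam hα).sub (hVc₁ (-lam) (-α) (neg_ne_zero.2 hlam) hα')).continuousOn)
    (fun x hx => (hu' x hx).sub ((hasDerivAt_exp_wkbPhase hα lam x).sub
      (hasDerivAt_exp_wkbPhase hα' (-lam) x)))
    (fun x hx => (hu₁' x hx).sub ((hasDerivAt_wkbSlope_mul_exp hα hlam x).sub
      (hasDerivAt_wkbSlope_mul_exp hα' (neg_ne_zero.2 hlam) x)))
    (fun x hx => by
      have hxI := Ioo_subset_Icc_self hx
      obtain ⟨-, h1, h2⟩ := hCb lam hlam1 hre x hxI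
      obtain ⟨-, h3, h4⟩ := hCb' (-lam) (by simpa using hlam1) (by simpa using hre) x hxI
      rw [norm_neg] at h4
      calc _ = ‖wkbResidual (-lam) (-α) x * Complex.exp (wkbPhase (-lam) (-α) x) -
            wkbResidual lam α x * Complex.exp (wkbPhase lam α x)‖ := by
            congr 1
            simp only [Pi.sub_apply, Pi.neg_apply]
            push_cast
            ring
        _ ≤ C' / ‖lam‖ ^ 2 * C' + C / ‖lam‖ ^ 2 * C := by
            refine (norm_sub_le _ _).trans ?_
            rw [norm_mul, norm_mul]
            gcongr
        _ = _ := by ring)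
    (by simp [h0, wkbPhase_zero]) (by simp [h0', wkbPhase_zero, wkbInitialSlope])
    (right_mem_Icc.2 zero_le_one)
  have hd : ‖u 1 - wkbEndValue lam α‖ * |lam.im| ≤ c * ((C * C + C' * C') / ‖lam‖ ^ 2) := key
  rw [le_div_iff₀ (by positivity)]
  have h1 := norm_le_mul_abs_im hre him
  have hl2 : (0 : ℝ) < ‖lam‖ ^ 2 := by positivity
  calc ‖u 1 - wkbEndValue lam α‖ * ‖lam‖ ^ 3
      = ‖u 1 - wkbEndValue lam α‖ * ‖lam‖ * ‖lam‖ ^ 2 := by ring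
    _ ≤ ‖u 1 - wkbEndValue lam α‖ * ((K + 1) * |lam.im|) * ‖lam‖ ^ 2 := by gcongr
    _ = (K + 1) * (‖u 1 - wkbEndValue lam α‖ * |lam.im|) * ‖lam‖ ^ 2 := by ring
    _ ≤ (K + 1) * (c * ((C * C + C' * C') / ‖lam‖ ^ 2)) * ‖lam‖ ^ 2 := by gcongr
    _ = _ := by field_simp

/-- High eigenvalues in a vertical strip nearly annihilate the WKB end value. -/
theorem exists_norm_wkbEndValue_le_of_mem_spectrum {a α : ℝ → ℝ} (hα : ContDiff ℝ 3 α)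
    (haα : EqOn α a (Icc 0 1)) (K : ℝ) :
    ∃ C, 0 ≤ C ∧ ∀ lam ∈ dampedWaveSpectrum a (fun _ => 0), |lam.re| ≤ K → 1 ≤ |lam.im| →
      ‖wkbEndValue lam α‖ ≤ C / ‖lam‖ ^ 3 := by
  obtain ⟨C, hC, hCb⟩ := exists_norm_sub_wkbEndValue_le hα K
  refine ⟨C, hC, ?_⟩
  rintro lam ⟨v, ⟨hv2, hode, hv0, hv1⟩, x₀, hx₀, hvx₀⟩ hre him
  obtain ⟨u, hu, huv⟩ := exists_contDiff_eqOn_Icc 2 v (by exact_mod_cast hv2)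
  have hI0 : (0 : ℝ) ∈ Icc (0 : ℝ) 1 := left_mem_Icc.2 zero_le_one
  have hI1 : (1 : ℝ) ∈ Icc (0 : ℝ) 1 := right_mem_Icc.2 zero_le_one
  have hu1 : ContDiff ℝ 1 (deriv u) :=
    (contDiff_succ_iff_deriv.1 (by exact_mod_cast hu : ContDiff ℝ ((1 : WithTop ℕ∞) + 1) u)).2.2
  have hd : ∀ x, HasDerivAt u (deriv u x) x := fun x =>
    (hu.differentiable (by norm_num) x).hasDerivAt
  have hd1 : ∀ x ∈ Ioo (0 : ℝ) 1,
      HasDerivAt (deriv u) ((lam ^ 2 + 2 * lam * (α x : ℂ)) * u x) x := by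
    intro x hx
    refine (hu1.differentiable (by norm_num) x).hasDerivAt.congr_deriv ?_
    have hev : u =ᶠ[𝓝 x] v := by
      filter_upwards [isOpen_Ioo.mem_nhds hx] with y hy using huv (Ioo_subset_Icc_self hy)
    have := hode x hx
    rw [← hev.deriv.deriv_eq, ← haα (Ioo_subset_Icc_self hx),
      ← huv (Ioo_subset_Icc_self hx)] at this
    simpa [sub_eq_zero] using this
  have hu0 : u 0 = 0 := (huv hI0).trans hv0
  have hu1' : u 1 = 0 := (huv hI1).trans hv1
  obtain ⟨A, hA, hAb⟩ := exists_abs_le_of_continuous hα.continuous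
  -- Uniqueness for the initial value problem is the energy estimate with `G = 0`. The eigenfunction
  -- can then be rescaled to the WKB initial slope.
  have hslope : deriv u 0 ≠ 0 := by
    intro h0
    have := norm_mul_abs_im_le_of_forced (G := 0) ((abs_nonneg _).trans hre) hA hre him hAb
      hu.continuous.continuousOn hu1.continuous.continuousOn (fun x _ => hd x) hd1
      (fun x hx => by simp) hu0 h0 hx₀
    rw [huv hx₀, mul_zero] at this
    have : 0 < ‖v x₀‖ * |lam.im| := mul_pos (norm_pos_iff.2 hvx₀) (by linarith)
    linarith
  set s := wkbInitialSlope lam α / deriv u 0 with hs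
  have := hCb lam hre him (fun x => s * u x) (fun x => s * deriv u x)
    (hu.continuous.const_mul _).continuousOn (hu1.continuous.const_mul _).continuousOn
    (fun x _ => (hd x).const_mul _)
    (fun x hx => ((hd1 x hx).const_mul s).congr_deriv (by ring)) (by simp [hu0])
    (by simp only [hs]; field_simp)
  simpa [hu1'] using this

theorem exists_norm_wkbInitialSlope_sub_le (α : ℝ → ℝ) :
    ∃ B, 0 ≤ B ∧ ∀ lam : ℂ, 1 ≤ ‖lam‖ → ‖wkbInitialSlope lam α - 2 * lam‖ ≤ B := by
  refine ⟨‖(2 * α 0 : ℂ)‖ + ‖(wkbCoeff₁ α 0 + wkbCoeff₁ (-α) 0 : ℂ)‖ +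
    ‖(wkbCoeff₂ α 0 - wkbCoeff₂ (-α) 0 : ℂ)‖, by positivity, fun lam hlam => ?_⟩
  have h : wkbInitialSlope lam α - 2 * lam = 2 * α 0 +
      (wkbCoeff₁ α 0 + wkbCoeff₁ (-α) 0 : ℂ) / lam ^ 1 +
      (wkbCoeff₂ α 0 - wkbCoeff₂ (-α) 0 : ℂ) / lam ^ 2 := by
    have : lam ≠ 0 := norm_pos_iff.1 (by linarith)
    simp only [wkbInitialSlope, wkbSlope, Pi.neg_apply]
    push_cast
    field_simp
    ring
  rw [h]
  refine (norm_add_le _ _).trans (add_le_add ((norm_add_le _ _).trans (add_le_add le_rfl ?_)) ?_)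
  · simpa using norm_div_pow_le (n := 1) hlam (Nat.zero_le _) le_rfl
  · simpa using norm_div_pow_le (n := 2) hlam (Nat.zero_le _) le_rfl

theorem differentiableAt_wkbInitialSlope (α : ℝ → ℝ) {lam : ℂ} (h : lam ≠ 0) :
    DifferentiableAt ℂ (fun lam => wkbInitialSlope lam α) lam := by
  have h2 : lam ^ 2 ≠ 0 := pow_ne_zero 2 h
  have h3 : -lam ≠ 0 := neg_ne_zero.2 h
  have h4 : (-lam) ^ 2 ≠ 0 := pow_ne_zero 2 h3
  simp only [wkbInitialSlope, wkbSlope]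
  fun_prop (disch := assumption)

/-- To leading order the end value is `2 sinh (lam + ⟨α⟩)`, whose zeros are explicit. -/
theorem exists_norm_wkbEndValue_sub_le {α : ℝ → ℝ} (hα : ContDiff ℝ 3 α) (K : ℝ) :
    ∃ C, 0 ≤ C ∧ ∀ lam : ℂ, |lam.re| ≤ K → 1 ≤ ‖lam‖ →
      ‖wkbEndValue lam α - (Complex.exp (lam + (∫ t in (0 : ℝ)..1, α t : ℝ)) -
        Complex.exp (-(lam + (∫ t in (0 : ℝ)..1, α t : ℝ))))‖ ≤ C / ‖lam‖ := by
  have key : ∀ β : ℝ → ℝ, ContDiff ℝ 3 β → ∃ C, 0 ≤ C ∧ ∀ μ : ℂ, |μ.re| ≤ K → 1 ≤ ‖μ‖ →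
      ‖Complex.exp (wkbPhase μ β 1) - Complex.exp (μ + (∫ t in (0 : ℝ)..1, β t : ℝ))‖ ≤
        C / ‖μ‖ := by
    intro β hβ
    obtain ⟨C, hC, hCb⟩ := exists_wkb_bound hβ K
    set m := ∫ t in (0 : ℝ)..1, β t with hm
    set c := Real.exp (K + |m|) with hc
    have hc0 : 0 < c := Real.exp_pos _
    refine ⟨c * (2 * C) + (C + c) * C, by positivity, fun μ hre hμ => ?_⟩
    have hμ0 : 0 < ‖μ‖ := by linarith
    obtain ⟨h1, h2, -⟩ := hCb μ hμ hre 1 (right_mem_Icc.2 zero_le_one)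
    rw [← hm, Complex.ofReal_one, mul_one] at h1
    have h3 : ‖Complex.exp (μ + (m : ℂ))‖ ≤ c := by
      rw [Complex.norm_exp, hc, Real.exp_le_exp]
      simpa using add_le_add ((le_abs_self _).trans hre) (le_abs_self m)
    rcases le_or_gt (C / ‖μ‖) 1 with hsmall | hbig
    · have h4 : Complex.exp (wkbPhase μ β 1) - Complex.exp (μ + (m : ℂ)) =
          Complex.exp (μ + (m : ℂ)) * (Complex.exp (wkbPhase μ β 1 - (μ + (m : ℂ))) - 1) := by
        rw [mul_sub, ← Complex.exp_add]
        simp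
      rw [h4, norm_mul]
      calc _ ≤ c * (2 * (C / ‖μ‖)) := by
            gcongr
            exact (Complex.norm_exp_sub_one_le (h1.trans hsmall)).trans (by gcongr)
        _ = (c * (2 * C)) / ‖μ‖ := by ring
        _ ≤ _ := by
            gcongr
            have : 0 ≤ (C + c) * C := by positivity
            linarith
    · calc _ ≤ C + c := (norm_sub_le _ _).trans (add_le_add h2 h3)
        _ ≤ (C + c) * (C / ‖μ‖) := le_mul_of_one_le_right (by positivity) hbig.le
        _ = ((C + c) * C) / ‖μ‖ := by ring
        _ ≤ _ := by
            gcongr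
            have : 0 ≤ c * (2 * C) := by positivity
            linarith
  obtain ⟨C, hC, h⟩ := key α hα
  obtain ⟨C', hC', h'⟩ := key (-α) hα.neg
  refine ⟨C + C', by positivity, fun lam hre hlam => ?_⟩
  have h1 := h lam hre hlam
  have h2 := h' (-lam) (by simpa using hre) (by simpa using hlam)
  rw [norm_neg] at h2
  simp only [Pi.neg_apply, integral_neg, Complex.ofReal_neg] at h2
  rw [add_div]
  calc _ = ‖(Complex.exp (wkbPhase lam α 1) - Complex.exp (lam + (∫ t in (0 : ℝ)..1, α t : ℝ))) -
        (Complex.exp (wkbPhase (-lam) (-α) 1) -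
          Complex.exp (-lam + -(∫ t in (0 : ℝ)..1, α t : ℝ)))‖ := by
        congr 1
        rw [wkbEndValue, neg_add]
        ring
    _ ≤ _ := (norm_sub_le _ _).trans (add_le_add h1 h2)

/-! ### Existence of large eigenvalues -/

theorem mem_dampedWaveSpectrum_of_hasDerivAt {a : ℝ → ℝ} {α : ℝ → ℝ} (hα : Continuous α)
    (haα : EqOn α a (Icc 0 1)) {lam : ℂ} {w w₁ : ℝ → ℂ} (hw : ContinuousOn w (Icc 0 1))
    (hw₁ : ContinuousOn w₁ (Icc 0 1)) (hd : ∀ x ∈ Ioo (0 : ℝ) 1, HasDerivAt w (w₁ x) x)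
    (hd₁ : ∀ x ∈ Ioo (0 : ℝ) 1,
      HasDerivAt w₁ ((lam ^ 2 + 2 * lam * (α x : ℂ)) * w x) x)
    (h0 : w 0 = 0) (h1 : w 1 = 0) (h0' : w₁ 0 ≠ 0) :
    lam ∈ dampedWaveSpectrum a (fun _ => 0) := by
  refine ⟨w, ⟨?_, ?_, h0, h1⟩, ?_⟩
  · have hc : ContDiffOn ℝ (0 : ℕ) (fun x => (lam ^ 2 + 2 * lam * (α x : ℂ)) * w x) (Icc 0 1) := by
      have : ContinuousOn (fun x => (lam ^ 2 + 2 * lam * (α x : ℂ)) * w x) (Icc 0 1) := by fun_prop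
      simpa using this
    exact_mod_cast contDiffOn_succ_of_hasDerivAt_Ioo hw
      (contDiffOn_succ_of_hasDerivAt_Ioo hw₁ hc hd₁) hd
  · intro x hx
    have hev : deriv w =ᶠ[𝓝 x] w₁ := by
      filter_upwards [isOpen_Ioo.mem_nhds hx] with y hy using (hd y hy).deriv
    rw [hev.deriv_eq, (hd₁ x hx).deriv, haα (Ioo_subset_Icc_self hx)]
    simp
  · by_contra! hz
    have hw₁0 : ∀ x ∈ Ioo (0 : ℝ) 1, w₁ x = 0 := by
      intro x hx
      have hev : w =ᶠ[𝓝 x] fun _ => 0 := by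
        filter_upwards [isOpen_Ioo.mem_nhds hx] with y hy using hz y (Ioo_subset_Icc_self hy)
      rw [← (hd x hx).deriv, hev.deriv_eq]
      simp
    have ht : Tendsto w₁ (𝓝[Ioo 0 1] 0) (𝓝 (w₁ 0)) :=
      ((hw₁ 0 (left_mem_Icc.2 zero_le_one)).mono Ioo_subset_Icc_self)
    have ht0 : Tendsto w₁ (𝓝[Ioo 0 1] 0) (𝓝 0) :=
      tendsto_const_nhds.congr' (by
        filter_upwards [self_mem_nhdsWithin] with x hx using (hw₁0 x hx).symm)
    have : (𝓝[Ioo (0 : ℝ) 1] 0).NeBot := left_nhdsWithin_Ioo_neBot zero_lt_one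
    exact h0' (tendsto_nhds_unique ht ht0)

theorem le_norm_exp_sub_exp_neg {w : ℂ} (hw : ‖w‖ ≤ 1) :
    2 * ‖w‖ - 2 * ‖w‖ ^ 2 ≤ ‖Complex.exp w - Complex.exp (-w)‖ := by
  have h1 := Complex.norm_exp_sub_one_sub_id_le hw
  have h2 := Complex.norm_exp_sub_one_sub_id_le (x := -w) (by simpa using hw)
  rw [norm_neg] at h2
  have h3 : 2 * w = (Complex.exp w - Complex.exp (-w)) -
      ((Complex.exp w - 1 - w) - (Complex.exp (-w) - 1 - -w)) := by ring
  have h4 := norm_sub_le (Complex.exp w - Complex.exp (-w))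
    ((Complex.exp w - 1 - w) - (Complex.exp (-w) - 1 - -w))
  rw [← h3, norm_mul, Complex.norm_ofNat] at h4
  have h5 := norm_sub_le (Complex.exp w - 1 - w) (Complex.exp (-w) - 1 - -w)
  linarith

/-- The spectrum contains a point close to `-⟨α⟩ + 2 π i n` for all large `n`. -/
theorem exists_mem_dampedWaveSpectrum {a α : ℝ → ℝ} (hα : ContDiff ℝ 3 α)
    (haα : EqOn α a (Icc 0 1)) (R : ℝ) :
    ∃ lam ∈ dampedWaveSpectrum a (fun _ => 0),
      |lam.re| ≤ |∫ t in (0 : ℝ)..1, α t| + 1 ∧ R ≤ |lam.im| := by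
  set m := ∫ t in (0 : ℝ)..1, α t with hm
  obtain ⟨w, w₁, hw0, hw₁0, hwc, hw₁c, hwd, hw₁d, hwh⟩ := exists_holomorphic_solution hα.continuous
  obtain ⟨B, hB, hBb⟩ := exists_norm_wkbInitialSlope_sub_le α
  obtain ⟨C, hC, hCb⟩ := exists_norm_sub_wkbEndValue_le hα (|m| + 1)
  obtain ⟨C', hC', hCb'⟩ := exists_norm_wkbEndValue_sub_le hα (|m| + 1)
  have hIoo : ∀ x ∈ Ioo (0 : ℝ) 1, x ∈ Ioo (0 : ℝ) 2 := fun x hx => ⟨hx.1, by linarith [hx.2]⟩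
  -- `32 (C + C')` makes the error of the `sinh` approximation at most `1/32`. `B` keeps the initial
  -- slope, which is `2 lam` up to `B`, away from zero.
  set T := max R 0 + 1 + B + 32 * (C + C') with hT
  obtain ⟨n, hn⟩ := exists_nat_ge T
  have hT1 : 1 ≤ T := by have := le_max_right R 0; rw [hT]; linarith
  set z₀ : ℂ := -m + n * (2 * Real.pi * Complex.I) with hz₀
  have hz₀re : z₀.re = -m := by simp [hz₀]
  have hz₀im : z₀.im = n * (2 * Real.pi) := by simp [hz₀]
  have hre : ∀ lam ∈ Metric.ball z₀ 1, |lam.re| ≤ |m| + 1 := by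
    intro lam hl
    have h1 := (Complex.abs_re_le_norm (lam - z₀)).trans (mem_ball_iff_norm.1 hl).le
    rw [Complex.sub_re, hz₀re, sub_neg_eq_add] at h1
    have := abs_sub (lam.re + m) m
    rw [add_sub_cancel_right] at this
    linarith
  have him : ∀ lam ∈ Metric.ball z₀ 1, T ≤ |lam.im| := by
    intro lam hl
    have h1 := (Complex.abs_im_le_norm (lam - z₀)).trans (mem_ball_iff_norm.1 hl).le
    rw [Complex.sub_im, hz₀im] at h1
    have h2 := (abs_le.1 h1).1
    refine le_trans ?_ (le_abs_self _)
    nlinarith [Real.pi_gt_three]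
  have hnorm : ∀ lam ∈ Metric.ball z₀ 1, T ≤ ‖lam‖ := fun lam hl =>
    (him lam hl).trans (Complex.abs_im_le_norm _)
  set G : ℂ → ℂ := fun lam => wkbInitialSlope lam α * w lam 1 with hG
  set S : ℂ → ℂ := fun lam => Complex.exp (lam + m) - Complex.exp (-(lam + m)) with hS
  have hGS : ∀ lam ∈ Metric.ball z₀ 1, ‖G lam - S lam‖ ≤ 1 / 32 := by
    intro lam hl
    have hn1 : 1 ≤ ‖lam‖ := hT1.trans (hnorm lam hl)
    have h1 := hCb lam (hre lam hl) (hT1.trans (him lam hl))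
      (fun x => wkbInitialSlope lam α * w lam x) (fun x => wkbInitialSlope lam α * w₁ lam x)
      (continuousOn_const.mul (hwc lam)) (continuousOn_const.mul (hw₁c lam))
      (fun x hx => (hwd lam x (hIoo x hx)).const_mul _)
      (fun x hx => ((hw₁d lam x (hIoo x hx)).const_mul _).congr_deriv (by ring))
      (by simp [hw0]) (by simp [hw₁0])
    have h2 := hCb' lam (hre lam hl) hn1
    have h3 : C / ‖lam‖ ^ 3 ≤ C / ‖lam‖ := by
      gcongr
      exact le_self_pow₀ hn1 (by norm_num)
    have h4 : C / ‖lam‖ + C' / ‖lam‖ ≤ 1 / 32 := by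
      rw [← add_div, div_le_iff₀ (by linarith)]
      have := hnorm lam hl
      have := le_max_right R 0
      linarith
    calc _ = ‖(G lam - wkbEndValue lam α) + (wkbEndValue lam α - S lam)‖ := by congr 1; ring
      _ ≤ _ := (norm_add_le _ _).trans ((add_le_add (h1.trans h3) h2).trans h4)
  have hSw : ∀ lam, S lam = Complex.exp (lam - z₀) - Complex.exp (-(lam - z₀)) := by
    intro lam
    have e1 : lam + m = (lam - z₀) + n * (2 * Real.pi * Complex.I) := by rw [hz₀]; ring
    have e2 : -(lam + m) = -(lam - z₀) - n * (2 * Real.pi * Complex.I) := by rw [hz₀]; ring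
    simp only [hS]
    rw [e2, e1, Complex.exp_periodic.nat_mul n, Complex.exp_periodic.sub_nat_mul_eq n]
  have hz₀mem : z₀ ∈ Metric.ball z₀ 1 := Metric.mem_ball_self one_pos
  have hsub : Metric.closedBall z₀ (1 / 4) ⊆ Metric.ball z₀ 1 :=
    Metric.closedBall_subset_ball (by norm_num)
  have hGz₀ : ‖G z₀‖ ≤ 1 / 32 := by simpa [hSw] using hGS z₀ hz₀mem
  have hGd : DifferentiableOn ℂ G (Metric.ball z₀ 1) := fun lam hl =>
    ((differentiableAt_wkbInitialSlope α
      (norm_pos_iff.1 (by linarith [hnorm lam hl]))).mul (hwh lam)).differentiableWithinAt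
  -- On the circle `|S| ≥ 2/4 - 2/16 = 3/8`. Subtracting two errors of `1/32` leaves `5/16`.
  have hsphere : ∀ z ∈ Metric.sphere z₀ (1 / 4), 5 / 16 ≤ ‖G z - G z₀‖ := by
    intro z hz
    have hzn : ‖z - z₀‖ = 1 / 4 := mem_sphere_iff_norm.1 hz
    have h1 := le_norm_exp_sub_exp_neg (w := z - z₀) (by rw [hzn]; norm_num)
    rw [← hSw, hzn] at h1
    have h2 := hGS z (hsub (Metric.sphere_subset_closedBall hz))
    have h3 : S z = (G z - G z₀) + G z₀ - (G z - S z) := by ring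
    have h4 := norm_sub_le ((G z - G z₀) + G z₀) (G z - S z)
    have h5 := norm_add_le (G z - G z₀) (G z₀)
    rw [← h3] at h4
    linarith
  have hfreq : ∃ᶠ z in 𝓝 z₀, G z ≠ G z₀ := by
    rw [Filter.Frequently]
    intro hev
    simp only [not_not] at hev
    have heq := (hGd.analyticOnNhd Metric.isOpen_ball).eqOn_of_preconnected_of_eventuallyEq
      (analyticOnNhd_const (v := G z₀)) (convex_ball z₀ 1).isPreconnected hz₀mem hev
    have hz1 : z₀ + (1 / 4 : ℝ) ∈ Metric.sphere z₀ (1 / 4) := by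
      rw [mem_sphere_iff_norm, add_sub_cancel_left, Complex.norm_real]
      norm_num
    have := hsphere _ hz1
    rw [heq (hsub (Metric.sphere_subset_closedBall hz1)), sub_self, norm_zero] at this
    norm_num at this
  -- By the quantitative open mapping theorem the image of the small disc contains the disc of
  -- radius `5/32` about `G z₀`, hence `0`, since `‖G z₀‖ ≤ 1/32`.
  obtain ⟨lam, hlam, hGlam⟩ := (hGd.diffContOnCl_ball hsub).ball_subset_image_closedBall
    (by norm_num) hsphere hfreq (show (0 : ℂ) ∈ Metric.ball (G z₀) (5 / 16 / 2) by
      rw [mem_ball_iff_norm, zero_sub, norm_neg]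
      linarith)
  have hl := hsub hlam
  have hslope : wkbInitialSlope lam α ≠ 0 := by
    intro h
    have h1 := hBb lam (hT1.trans (hnorm lam hl))
    rw [h, zero_sub, norm_neg, norm_mul, Complex.norm_ofNat] at h1
    have := hnorm lam hl
    have := le_max_right R 0
    linarith
  have hw1 : w lam 1 = 0 := (mul_eq_zero.1 hGlam).resolve_left hslope
  refine ⟨lam, mem_dampedWaveSpectrum_of_hasDerivAt hα.continuous haα (hwc lam) (hw₁c lam)
    (fun x hx => hwd lam x (hIoo x hx)) (fun x hx => hw₁d lam x (hIoo x hx)) (hw0 lam) hw1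
    (by simp [hw₁0]), hre lam hl, ?_⟩
  have := him lam hl
  have := le_max_left R 0
  linarith

/-! ### Asymptotic invariants of the spectrum -/

/-- The coefficient of `lam⁻²` in the difference of the two WKB phases. -/
noncomputable def wkbCubicInvariant (α : ℝ → ℝ) : ℝ :=
  (∫ t in (0 : ℝ)..1, α t ^ 3) + (deriv α 1 - deriv α 0) / 2

/-- Under `(lam, α) ↦ (-lam, -α)` only the part of `c₁` even in `α` and the part of `c₂` odd in `α`
survive, namely `-α² / 2` and `α'' / 4 + α³ / 2`. -/
theorem wkbPhase_sub_wkbPhase_neg {α : ℝ → ℝ} (hα : ContDiff ℝ 3 α) {lam : ℂ} (hlam : lam ≠ 0) :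
    wkbPhase lam α 1 - wkbPhase (-lam) (-α) 1 =
      2 * (lam + (∫ t in (0 : ℝ)..1, α t : ℝ)) - (∫ t in (0 : ℝ)..1, α t ^ 2 : ℝ) / lam +
        wkbCubicInvariant α / lam ^ 2 := by
  have hα' : ContDiff ℝ 3 (-α) := hα.neg
  have hd : deriv (-α) = -deriv α := funext fun x => deriv.neg
  have hd2 : deriv (-deriv α) = -deriv (deriv α) := funext fun x => deriv.neg
  have h1 : (∫ t in (0 : ℝ)..1, wkbCoeff₁ α t) + ∫ t in (0 : ℝ)..1, wkbCoeff₁ (-α) t =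
      -∫ t in (0 : ℝ)..1, α t ^ 2 := by
    rw [← integral_add ((contDiff_wkbCoeff₁ hα).continuous.intervalIntegrable _ _)
      ((contDiff_wkbCoeff₁ hα').continuous.intervalIntegrable _ _), ← integral_neg]
    congr 1 with t
    simp only [wkbCoeff₁, hd, Pi.neg_apply]
    ring
  have c1 : ContDiff ℝ 2 (deriv α) := contDiff_deriv_of_succ 2 (by exact_mod_cast hα)
  have c2 : Continuous (deriv (deriv α)) :=
    (contDiff_deriv_of_succ 1 (by exact_mod_cast c1)).continuous
  have h2 : (∫ t in (0 : ℝ)..1, wkbCoeff₂ α t) - ∫ t in (0 : ℝ)..1, wkbCoeff₂ (-α) t =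
      wkbCubicInvariant α := by
    have hftc : ∫ t in (0 : ℝ)..1, deriv (deriv α) t = deriv α 1 - deriv α 0 :=
      integral_deriv_eq_sub (fun x _ => c1.differentiable (by norm_num) x)
        (c2.intervalIntegrable _ _)
    have c0 := hα.continuous
    rw [← integral_sub ((contDiff_wkbCoeff₂ hα).continuous.intervalIntegrable _ _)
      ((contDiff_wkbCoeff₂ hα').continuous.intervalIntegrable _ _), wkbCubicInvariant, ← hftc,
      ← integral_div, ← integral_add (Continuous.intervalIntegrable (by fun_prop) _ _)
        (Continuous.intervalIntegrable (by fun_prop) _ _)]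
    congr 1 with t
    simp only [wkbCoeff₂, hd, hd2, Pi.neg_apply]
    ring
  have h1' := congrArg (fun r : ℝ => (r : ℂ)) h1
  have h2' := congrArg (fun r : ℝ => (r : ℂ)) h2
  simp only [Complex.ofReal_add, Complex.ofReal_sub, Complex.ofReal_neg] at h1' h2'
  rw [← h2', ← neg_neg (((∫ t in (0 : ℝ)..1, α t ^ 2 : ℝ) : ℂ)), ← h1']
  simp only [wkbPhase, Pi.neg_apply, integral_neg, Complex.ofReal_neg]
  push_cast
  field_simp
  ring

/-- The small end value is divided by its second exponential, whose inverse is bounded in the strip.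
-/
theorem exists_norm_exp_sub_one_le_of_mem_spectrum {a α : ℝ → ℝ} (hα : ContDiff ℝ 3 α)
    (haα : EqOn α a (Icc 0 1)) (K : ℝ) :
    ∃ C, 0 ≤ C ∧ ∀ lam ∈ dampedWaveSpectrum a (fun _ => 0), |lam.re| ≤ K → 1 ≤ |lam.im| →
      ‖Complex.exp (2 * (lam + (∫ t in (0 : ℝ)..1, α t : ℝ)) -
        (∫ t in (0 : ℝ)..1, α t ^ 2 : ℝ) / lam + wkbCubicInvariant α / lam ^ 2) - 1‖ ≤
        C / ‖lam‖ ^ 3 := by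
  obtain ⟨C, hC, hCb⟩ := exists_norm_wkbEndValue_le_of_mem_spectrum hα haα K
  obtain ⟨C', hC', hCb'⟩ := exists_wkb_bound (α := -α) hα.neg K
  set m := ∫ t in (0 : ℝ)..1, (-α) t with hm
  refine ⟨Real.exp (K + |m| + C') * C, by positivity, fun lam hspec hre him => ?_⟩
  have hlam1 : 1 ≤ ‖lam‖ := him.trans (Complex.abs_im_le_norm _)
  have hlam : lam ≠ 0 := norm_pos_iff.1 (by linarith)
  have h1 := hCb lam hspec hre him
  have h2 := (hCb' (-lam) (by simpa using hlam1) (by simpa using hre) 1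
    (right_mem_Icc.2 zero_le_one)).1
  rw [← hm, norm_neg, Complex.ofReal_one, mul_one] at h2
  have h2' : C' / ‖lam‖ ≤ C' := div_le_self hC' hlam1
  have h3 := (abs_le.1 ((Complex.abs_re_le_norm _).trans (h2.trans h2'))).1
  simp only [Complex.sub_re, Complex.add_re, Complex.neg_re, Complex.ofReal_re] at h3
  have h4 : ‖Complex.exp (-wkbPhase (-lam) (-α) 1)‖ ≤ Real.exp (K + |m| + C') := by
    rw [Complex.norm_exp, Real.exp_le_exp, Complex.neg_re]
    have := (le_abs_self _).trans hre
    have := neg_abs_le m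
    linarith
  rw [← wkbPhase_sub_wkbPhase_neg hα hlam]
  have h5 : Complex.exp (wkbPhase lam α 1 - wkbPhase (-lam) (-α) 1) - 1 =
      Complex.exp (-wkbPhase (-lam) (-α) 1) * wkbEndValue lam α := by
    rw [wkbEndValue, mul_sub, ← Complex.exp_add, ← Complex.exp_add, neg_add_cancel,
      Complex.exp_zero, neg_add_eq_sub]
  rw [h5, norm_mul, mul_div_assoc]
  gcongr

theorem eq_zero_of_forall_le_div {p C : ℝ} (h : ∀ R : ℝ, ∃ r, R ≤ r ∧ 1 ≤ r ∧ |p| ≤ C / r) :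
    p = 0 := by
  by_contra hp
  have hp' : 0 < |p| := abs_pos.2 hp
  obtain ⟨r, hr, hr1, hle⟩ := h (C / |p| + 1)
  rw [le_div_iff₀ (by linarith)] at hle
  have : C / |p| < r := by linarith
  rw [div_lt_iff₀ hp'] at this
  linarith

theorem eq_zero_of_norm_div_add_div_le {p q C : ℝ}
    (h : ∀ R : ℝ, ∃ z : ℂ, R ≤ ‖z‖ ∧ 1 ≤ ‖z‖ ∧ ‖(p : ℂ) / z + q / z ^ 2‖ ≤ C / ‖z‖ ^ 3) :
    p = 0 ∧ q = 0 := by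
  have hp : p = 0 := by
    refine eq_zero_of_forall_le_div (C := |q| + C) fun R => ?_
    obtain ⟨z, hR, h1, hz⟩ := h R
    refine ⟨‖z‖, hR, h1, ?_⟩
    have hz0 : z ≠ 0 := norm_pos_iff.1 (by linarith)
    have hzp : 0 < ‖z‖ := by linarith
    have hC : 0 ≤ C := by
      have := (norm_nonneg _).trans hz
      by_contra! hneg
      exact absurd this (not_le.2 (div_neg_of_neg_of_pos hneg (by positivity)))
    have e : (p : ℂ) = z * ((p : ℂ) / z + q / z ^ 2) - q / z := by field_simp; ring
    calc |p| = ‖(p : ℂ)‖ := by rw [Complex.norm_real, Real.norm_eq_abs]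
      _ ≤ ‖z‖ * (C / ‖z‖ ^ 3) + |q| / ‖z‖ := by
          rw [e]
          refine (norm_sub_le _ _).trans ?_
          rw [norm_mul, norm_div, Complex.norm_real, Real.norm_eq_abs]
          gcongr
      _ = C / ‖z‖ ^ 2 + |q| / ‖z‖ := by field_simp
      _ ≤ C / ‖z‖ + |q| / ‖z‖ := by
          gcongr
          exact le_self_pow₀ h1 two_ne_zero
      _ = _ := by ring
  refine ⟨hp, eq_zero_of_forall_le_div (C := C) fun R => ?_⟩
  obtain ⟨z, hR, h1, hz⟩ := h R
  refine ⟨‖z‖, hR, h1, ?_⟩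
  have hzp : 0 < ‖z‖ := by linarith
  rw [hp, Complex.ofReal_zero, zero_div, zero_add, norm_div, norm_pow, Complex.norm_real,
    Real.norm_eq_abs, div_le_iff₀ (by positivity)] at hz
  refine hz.trans (le_of_eq ?_)
  field_simp

/-- Isospectral dampings with the same mean share the next two asymptotic invariants. -/
theorem invariants_eq_of_dampedWaveSpectrum_eq {a₁ a₂ α₁ α₂ : ℝ → ℝ} (h₁ : ContDiff ℝ 3 α₁)
    (h₂ : ContDiff ℝ 3 α₂) (ha₁ : EqOn α₁ a₁ (Icc 0 1)) (ha₂ : EqOn α₂ a₂ (Icc 0 1))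
    (hmean : ∫ t in (0 : ℝ)..1, α₁ t = ∫ t in (0 : ℝ)..1, α₂ t)
    (hspec : dampedWaveSpectrum a₁ (fun _ => 0) = dampedWaveSpectrum a₂ (fun _ => 0)) :
    ∫ t in (0 : ℝ)..1, α₁ t ^ 2 = ∫ t in (0 : ℝ)..1, α₂ t ^ 2 ∧
      wkbCubicInvariant α₁ = wkbCubicInvariant α₂ := by
  set K := |∫ t in (0 : ℝ)..1, α₁ t| + 1 with hK
  obtain ⟨C₁, hC₁, hb₁⟩ := exists_norm_exp_sub_one_le_of_mem_spectrum h₁ ha₁ K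
  obtain ⟨C₂, hC₂, hb₂⟩ := exists_norm_exp_sub_one_le_of_mem_spectrum h₂ ha₂ K
  rw [← hmean] at hb₂
  set m := ∫ t in (0 : ℝ)..1, α₁ t
  set s₁ := ∫ t in (0 : ℝ)..1, α₁ t ^ 2
  set s₂ := ∫ t in (0 : ℝ)..1, α₂ t ^ 2
  set c₁ := wkbCubicInvariant α₁
  set c₂ := wkbCubicInvariant α₂
  suffices s₂ - s₁ = 0 ∧ c₁ - c₂ = 0 from ⟨by linarith [this.1], by linarith [this.2]⟩
  refine eq_zero_of_norm_div_add_div_le (C := 4 * (C₁ + C₂)) fun R => ?_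
  -- `2 C₂` forces `‖exp F₂‖ ≥ 1/2`, and the last summand forces `‖δ‖ ≤ 1/2`. Smallness of `δ`
  -- removes any `2πi` ambiguity in comparing the exponents.
  set T := |R| + 1 + 2 * C₂ + 2 * (|s₂ - s₁| + |c₁ - c₂|) with hT
  have hT1 : 1 ≤ T := by
    rw [hT]
    have := abs_nonneg R
    have := abs_nonneg (s₂ - s₁)
    have := abs_nonneg (c₁ - c₂)
    linarith
  obtain ⟨lam, hmem, hre, him⟩ := exists_mem_dampedWaveSpectrum h₁ ha₁ T
  have hnorm : T ≤ ‖lam‖ := him.trans (Complex.abs_im_le_norm _)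
  have hlam1 : 1 ≤ ‖lam‖ := hT1.trans hnorm
  have hlam : lam ≠ 0 := norm_pos_iff.1 (by linarith)
  have hTa : |R| + 1 + 2 * C₂ + 2 * (|s₂ - s₁| + |c₁ - c₂|) ≤ ‖lam‖ := hnorm
  have a1 := abs_nonneg R
  have a2 := abs_nonneg (s₂ - s₁)
  have a3 := abs_nonneg (c₁ - c₂)
  refine ⟨lam, by linarith [le_abs_self R], hlam1, ?_⟩
  have e₁ := hb₁ lam hmem hre (hT1.trans him)
  have e₂ := hb₂ lam (hspec ▸ hmem) hre (hT1.trans him)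
  set F₁ : ℂ := 2 * (lam + m) - s₁ / lam + c₁ / lam ^ 2 with hF₁
  set F₂ : ℂ := 2 * (lam + m) - s₂ / lam + c₂ / lam ^ 2 with hF₂
  set δ : ℂ := ((s₂ - s₁ : ℝ) : ℂ) / lam + ((c₁ - c₂ : ℝ) : ℂ) / lam ^ 2 with hδ
  have hδF : F₁ = F₂ + δ := by
    rw [hF₁, hF₂, hδ]
    push_cast
    ring
  have hpow : ‖lam‖ ≤ ‖lam‖ ^ 3 := le_self_pow₀ hlam1 (by norm_num)
  have hexp : 1 / 2 ≤ ‖Complex.exp F₂‖ := by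
    have h3 : C₂ / ‖lam‖ ^ 3 ≤ 1 / 2 := by
      rw [div_le_iff₀ (by positivity)]
      linarith
    have h4 := norm_sub_norm_le (1 : ℂ) (1 - Complex.exp F₂)
    rw [sub_sub_cancel, norm_one, norm_sub_rev] at h4
    linarith
  have hδ1 : ‖δ‖ ≤ 1 / 2 := by
    have g1 := norm_div_pow_le (n := 1) (m := 1) hlam1 le_rfl
      (le_refl ‖((s₂ - s₁ : ℝ) : ℂ)‖)
    have g2 := norm_div_pow_le (n := 2) (m := 1) hlam1 one_le_two
      (le_refl ‖((c₁ - c₂ : ℝ) : ℂ)‖)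
    rw [Complex.norm_real, Real.norm_eq_abs, pow_one, pow_one] at g1
    rw [Complex.norm_real, Real.norm_eq_abs, pow_one] at g2
    refine (norm_add_le _ _).trans ((add_le_add g1 g2).trans ?_)
    rw [← add_div, div_le_iff₀ (by linarith)]
    linarith
  have hprod : ‖Complex.exp F₂‖ * ‖Complex.exp δ - 1‖ ≤ (C₁ + C₂) / ‖lam‖ ^ 3 := by
    rw [← norm_mul, mul_sub, ← Complex.exp_add, ← hδF, mul_one, add_div]
    calc _ = ‖(Complex.exp F₁ - 1) - (Complex.exp F₂ - 1)‖ := by congr 1; ring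
      _ ≤ _ := (norm_sub_le _ _).trans (add_le_add e₁ e₂)
  -- For `‖δ‖ ≤ 1/2` the quadratic remainder of `exp δ - 1` is at most `‖δ‖ / 2`.
  have hlow : ‖δ‖ / 2 ≤ ‖Complex.exp δ - 1‖ := by
    have g1 := Complex.norm_exp_sub_one_sub_id_le (hδ1.trans (by norm_num))
    have g2 := norm_sub_le (Complex.exp δ - 1) (Complex.exp δ - 1 - δ)
    rw [sub_sub_cancel] at g2
    nlinarith [norm_nonneg δ]
  have : 4 * (C₁ + C₂) / ‖lam‖ ^ 3 = 4 * ((C₁ + C₂) / ‖lam‖ ^ 3) := by ring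
  rw [this]
  nlinarith [norm_nonneg δ, mul_le_mul hexp hlow (by positivity) (norm_nonneg _)]

/-! ### Reflection symmetry and conclusion -/

theorem integral_eq_zero_of_reflect_neg {f : ℝ → ℝ}
    (h : ∀ x ∈ Icc (0 : ℝ) 1, f (1 - x) = -f x) : ∫ x in (0 : ℝ)..1, f x = 0 := by
  have h1 : ∫ x in (0 : ℝ)..1, f (1 - x) = ∫ x in (0 : ℝ)..1, f x := by
    simp [integral_comp_sub_left]
  have h2 : ∫ x in (0 : ℝ)..1, f (1 - x) = ∫ x in (0 : ℝ)..1, -f x :=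
    integral_congr fun x hx => h x (by rwa [uIcc_of_le zero_le_one] at hx)
  rw [integral_neg] at h2
  linarith

/-- The derivative of an odd function is even. The symmetry is known only on `[0,1]`, so it is
differentiated one-sidedly at `0`. -/
theorem deriv_one_eq_deriv_zero_of_reflect_neg {f : ℝ → ℝ} (hf : Differentiable ℝ f)
    (h : ∀ x ∈ Icc (0 : ℝ) 1, f (1 - x) = -f x) : deriv f 1 = deriv f 0 := by
  have hI0 : (0 : ℝ) ∈ Icc (0 : ℝ) 1 := left_mem_Icc.2 zero_le_one
  have h1 : HasDerivAt (fun x => f (1 - x)) (-deriv f 1) 0 := by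
    have hf1 : HasDerivAt f (deriv f 1) (1 - 0) := by
      rw [sub_zero]; exact (hf 1).hasDerivAt
    exact hf1.comp_const_sub 1 0
  have h2 : HasDerivWithinAt (fun x => f (1 - x)) (-deriv f 0) (Icc 0 1) 0 :=
    (hf 0).hasDerivAt.neg.hasDerivWithinAt.congr h (h 0 hI0)
  have := (uniqueDiffOn_Icc zero_lt_one 0 hI0).eq_deriv _ h1.hasDerivWithinAt h2
  linarith

/-- Integrals of the powers of a damping split into its even and odd parts. -/
theorem invariants_even_add_odd {A T : ℝ → ℝ} (hA : ContDiff ℝ 3 A) (hT : ContDiff ℝ 3 T)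
    (hsymm : ∀ x ∈ Icc (0 : ℝ) 1, A (1 - x) = A x)
    (hanti : ∀ x ∈ Icc (0 : ℝ) 1, T (1 - x) = -T x) :
    (∫ x in (0 : ℝ)..1, (A + T) x = ∫ x in (0 : ℝ)..1, A x) ∧
    (∫ x in (0 : ℝ)..1, (A + T) x ^ 2 =
      (∫ x in (0 : ℝ)..1, A x ^ 2) + ∫ x in (0 : ℝ)..1, T x ^ 2) ∧
    wkbCubicInvariant (A + T) =
      wkbCubicInvariant A + 3 * ∫ x in (0 : ℝ)..1, A x * T x ^ 2 := by
  have cA := hA.continuous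
  have cT := hT.continuous
  -- Every term of odd degree in `T` is odd under reflection and drops out of the integral.
  have hodd : ∀ f : ℝ → ℝ, Continuous f → ∀ g : ℝ → ℝ, Continuous g →
      (∀ x ∈ Icc (0 : ℝ) 1, g (1 - x) = -g x) →
      ∫ x in (0 : ℝ)..1, (f x + g x) = ∫ x in (0 : ℝ)..1, f x := by
    intro f hf g hg h
    rw [integral_add (hf.intervalIntegrable _ _) (hg.intervalIntegrable _ _),
      integral_eq_zero_of_reflect_neg h, add_zero]
  refine ⟨hodd A cA T cT hanti, ?_, ?_⟩
  · rw [← integral_add (Continuous.intervalIntegrable (by fun_prop) _ _)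
      (Continuous.intervalIntegrable (by fun_prop) _ _),
      ← hodd (fun x => A x ^ 2 + T x ^ 2) (by fun_prop) (fun x => 2 * A x * T x) (by fun_prop)
        (fun x hx => by simp only [hsymm x hx, hanti x hx]; ring)]
    congr 1 with x
    simp only [Pi.add_apply]
    ring
  · have hder : ∀ x, deriv (A + T) x = deriv A x + deriv T x := fun x =>
      deriv_add (hA.differentiable (by norm_num) x) (hT.differentiable (by norm_num) x)
    have hint : ∫ x in (0 : ℝ)..1, (A + T) x ^ 3 =
        (∫ x in (0 : ℝ)..1, A x ^ 3) + 3 * ∫ x in (0 : ℝ)..1, A x * T x ^ 2 := by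
      rw [← integral_const_mul, ← integral_add (Continuous.intervalIntegrable (by fun_prop) _ _)
        (Continuous.intervalIntegrable (by fun_prop) _ _),
        ← hodd (fun x => A x ^ 3 + 3 * (A x * T x ^ 2)) (by fun_prop) (fun x => 3 * A x ^ 2 * T x + T x ^ 3) (by fun_prop)
          (fun x hx => by simp only [hsymm x hx, hanti x hx]; ring)]
      congr 1 with x
      simp only [Pi.add_apply]
      ring
    rw [wkbCubicInvariant, wkbCubicInvariant, hder, hder, hint,
      deriv_one_eq_deriv_zero_of_reflect_neg (hT.differentiable (by norm_num)) hanti]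
    ring

theorem corollary3 (a₀ t₁ t₂ : ℝ → ℝ)
    (ha₀ : ContDiffOn ℝ 4 a₀ (Set.Icc 0 1))
    (ht₁ : ContDiffOn ℝ 4 t₁ (Set.Icc 0 1))
    (ht₂ : ContDiffOn ℝ 4 t₂ (Set.Icc 0 1))
    (hsymm : ∀ x ∈ Set.Icc (0 : ℝ) 1, a₀ (1 - x) = a₀ x)
    (hanti₁ : ∀ x ∈ Set.Icc (0 : ℝ) 1, t₁ (1 - x) = -t₁ x)
    (hanti₂ : ∀ x ∈ Set.Icc (0 : ℝ) 1, t₂ (1 - x) = -t₂ x)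
    (hspec : dampedWaveSpectrum (fun x => a₀ x + t₁ x) (fun _ => 0) =
      dampedWaveSpectrum (fun x => a₀ x + t₂ x) (fun _ => 0)) :
    unitMean (fun x => t₁ x ^ 2) = unitMean (fun x => t₂ x ^ 2) ∧
      unitMean (fun x => a₀ x * t₁ x ^ 2) = unitMean (fun x => a₀ x * t₂ x ^ 2) := by
  have hext : ∀ f : ℝ → ℝ, ContDiffOn ℝ 4 f (Icc 0 1) →
      ∃ g : ℝ → ℝ, ContDiff ℝ 3 g ∧ EqOn g f (Icc 0 1) := fun f hf =>
    exists_contDiff_eqOn_Icc 3 f (hf.of_le (by norm_num))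
  obtain ⟨A, hA, hAe⟩ := hext a₀ ha₀
  obtain ⟨T₁, hT₁, hT₁e⟩ := hext t₁ ht₁
  obtain ⟨T₂, hT₂, hT₂e⟩ := hext t₂ ht₂
  have hrefl : ∀ x ∈ Icc (0 : ℝ) 1, 1 - x ∈ Icc (0 : ℝ) 1 := fun x hx =>
    ⟨by linarith [hx.2], by linarith [hx.1]⟩
  have hAs : ∀ x ∈ Icc (0 : ℝ) 1, A (1 - x) = A x := fun x hx => by
    rw [hAe hx, hAe (hrefl x hx), hsymm x hx]
  obtain ⟨m₁, s₁, c₁⟩ := invariants_even_add_odd hA hT₁ hAs fun x hx => by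
    rw [hT₁e hx, hT₁e (hrefl x hx), hanti₁ x hx]
  obtain ⟨m₂, s₂, c₂⟩ := invariants_even_add_odd hA hT₂ hAs fun x hx => by
    rw [hT₂e hx, hT₂e (hrefl x hx), hanti₂ x hx]
  obtain ⟨hs, hc⟩ := invariants_eq_of_dampedWaveSpectrum_eq (α₁ := A + T₁) (α₂ := A + T₂)
    (hA.add hT₁) (hA.add hT₂)
    (fun x hx => by simp only [Pi.add_apply, hAe hx, hT₁e hx])
    (fun x hx => by simp only [Pi.add_apply, hAe hx, hT₂e hx]) (m₁.trans m₂.symm) hspec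
  have hmean : ∀ f g : ℝ → ℝ, EqOn f g (Icc 0 1) → unitMean g = ∫ x in (0 : ℝ)..1, f x :=
    fun f g h => integral_congr fun x hx => (h (by rwa [uIcc_of_le zero_le_one] at hx)).symm
  rw [hmean (fun x => T₁ x ^ 2) _ fun x hx => by simp only [hT₁e hx],
    hmean (fun x => T₂ x ^ 2) _ fun x hx => by simp only [hT₂e hx],
    hmean (fun x => A x * T₁ x ^ 2) _ fun x hx => by simp only [hAe hx, hT₁e hx],
    hmean (fun x => A x * T₂ x ^ 2) _ fun x hx => by simp only [hAe hx, hT₂e hx]]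
  constructor <;> linarith
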